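/- Let $t_0>0$, $t_2\in\mathbb C$ with $|t_2|<\frac12$, and $V(z)=\frac1{t_0}\left(|z|^2-t_2z^2-\bar t_2\bar z^2\right)$ for $z\in\mathbb C$. For a Borel probability measure $\mu$ on $\mathbb C$ without point masses let $$I(\mu)=\int V(z)\,d\mu(z)+\iint_{z\ne\zeta}\log|z-\zeta|^{-1}\,d\mu(\zeta)\,d\mu(z)\in(-\infty,\infty],$$ where $I(\mu)=+\infty$ if one of the two integrals does not converge absolutely. An equilibrium measure for $V$ on $\mathbb C$ is a Borel probability measure on $\mathbb C$ without point masses at which $I$ attains its infimum $I_0$ over all such measures. Put $$a=\sqrt{\frac{1+2|t_2|}{1-2|t_2|}\,t_0},\qquad b=\sqrt{\frac{1-2|t_2|}{1+2|t_2|}\,t_0},$$ and let $s\in\mathbb C$ be any number with $|s|=1$ and $s^2|t_2|=t_2$ (so $s=\sqrt{t_2}/\sqrt{|t_2|}$, with either square root, if $t_2\neq0$). Then the potential $V$ has exactly one equilibrium measure on $\mathbb C$, namely $$\mu=\frac1{\pi ab}\,\chi_{D_+}\lambda,$$ where $\lambda$ is Lebesgue measure on $\mathbb C$ and $D_+$ is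 the interior of the ellipse with semi-axes $a$ and $b$, $$D_+=\left\{z\in\mathbb C:\ \frac{(\operatorname{Re}(sz))^2}{a^2}+\frac{(\operatorname{Im}(sz))^2}{b^2}<1\right\}.$$ -/

import Mathlib

open MeasureTheory

noncomputable section

/-- The class `M(D)` of Borel probability measures on `D ⊆ ℂ` without point masses; a measure
on `D` is viewed as a measure on `ℂ` that gives no mass to the complement of `D`. -/
structure IsAdmissibleMeasure (D : Set ℂ) (μ : Measure ℂ) : Prop where
  isProbabilityMeasure : IsProbabilityMeasure μ
  measure_singleton : ∀ z : ℂ, μ {z} = 0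
  compl_eq_zero : μ Dᶜ = 0

/-- The logarithmic kernel `log |z - ζ|⁻¹`. On the diagonal, which the double integral in the
energy leaves out (`z ≠ ζ`), its value is `0`. -/
def logKernel (z ζ : ℂ) : ℝ := Real.log ‖z - ζ‖⁻¹

open Classical in
/-- The energy `I(μ) = ∫ V(z) dμ(z) + ∬_{z ≠ ζ} log |z - ζ|⁻¹ dμ(ζ) dμ(z)`, with values in
`(-∞, ∞]`. It is `+∞` if one of the two integrals does not converge absolutely. For the
admissible measures on a compact set and a continuous potential, and for the admissible measures
on `ℂ` and a potential that is bounded below by `c |z|²` with `c > 0`, this is the value of the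
sum of the two integrals whenever that sum makes sense in `[-∞, ∞]`: divergence is then to `+∞`,
apart from the undefined case `∞ - ∞`, to which the value `+∞` is given as usual. -/
def energy (V : ℂ → ℝ) (μ : Measure ℂ) : EReal :=
  if Integrable V μ ∧ Integrable (fun p : ℂ × ℂ => logKernel p.1 p.2) (μ.prod μ) then
    (((∫ z, V z ∂μ) + ∫ z, ∫ ζ, logKernel z ζ ∂μ ∂μ : ℝ) : EReal)
  else ⊤

/-- `μ` is an equilibrium measure for the potential `V` on `D`: it is a Borel probability measure
on `D` without point masses whose energy is the infimum `I₀` of the energies of all such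
measures. -/
def IsEquilibriumMeasure (V : ℂ → ℝ) (D : Set ℂ) (μ : Measure ℂ) : Prop :=
  IsAdmissibleMeasure D μ ∧
    energy V μ = ⨅ (ν : Measure ℂ) (_ : IsAdmissibleMeasure D ν), energy V ν

/-- The Gaussian potential
`V(z) = (|z|² - t₂ z² - conj t₂ * (conj z)²) / t₀ = (|z|² - 2 Re (t₂ z²)) / t₀`. -/
def gaussianPotential (t₀ : ℝ) (t₂ : ℂ) (z : ℂ) : ℝ :=
  (‖z‖ ^ 2 - 2 * (t₂ * z ^ 2).re) / t₀

/-- The interior of the ellipse `Re (s z)² / a² + Im (s z)² / b² = 1`; for `|s| = 1` it has the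
semi-axes `a`, `b`. -/
def ellipseInterior (s : ℂ) (a b : ℝ) : Set ℂ :=
  {z | (s * z).re ^ 2 / a ^ 2 + (s * z).im ^ 2 / b ^ 2 < 1}

end

noncomputable section

/-! The proof is the Frostman argument. Let `U` be the logarithmic potential of the candidate `μ₀`.
If `V + 2U = F` on its support and `V + 2U ≥ F` everywhere, then for a competitor `ν` of finite
energy, with `σ = ν - μ₀`, `I(ν) - I(μ₀) = ∫ (V + 2U) dσ + ∬ log |z - ζ|⁻¹ dσ dσ`, where the first
term is nonnegative by these conditions and the second because the kernel is positive definite on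
differences of probability measures, with equality only for `σ = 0` (`logEnergy_sub_nonneg`,
`eq_of_logEnergy_sub_eq_zero`).

Definiteness: Frullani's integral writes `2 log |x|⁻¹` as `∫ (exp (-t|x|²) - exp (-t)) dt / t`. The
subtracted term cancels in `σ`, and the Gaussian energy of `σ` is the integral of `|σ̂|²` against a
positive Gaussian (`gaussianEnergy_sub_sub`).

The potential of the ellipse: up to a rotation, `w ↦ αw + β conj w` maps the unit disk to the
ellipse with semi-axes `α ± β`, and the disk is swept out by circles `|w| = r`. On such a circle
`conj w = r²/w`, so `z - αw - β conj w` is a quadratic in `w` divided by `w`, and Jensen's formula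
gives its logarithmic mean as `log α + log r` plus a nonnegative `ellipseGreen`, which vanishes for
`z` inside the ellipse of parameter `r` (`circleAverage_log_norm_sub_ellipse`). Integrated against
`2r dr` over all `r` for which it is positive, `ellipseGreen` yields `V/2`, by an explicit primitive
(`integral_ellipseGreen_sqrt_level`). If `z` is in the ellipse, the range `0 < r < 1` covers all
these `r`, which gives the equality; otherwise part of a nonnegative integral is missing, which
gives the inequality. -/

/-! ### Frullani's integral and the logarithmic energy -/

open Set Filter Topology in
lemma abs_exp_neg_mul_sub_exp_neg_mul_le {a b t : ℝ} (hab : a ≤ b) (ht : 0 ≤ t) :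
    |Real.exp (-(a * t)) - Real.exp (-(b * t))| ≤ (b - a) * t * Real.exp (-(a * t)) := by
  have h1 : Real.exp (-(b * t)) = Real.exp (-(a * t)) * Real.exp (-((b - a) * t)) := by
    rw [← Real.exp_add]; ring_nf
  have h2 : 0 ≤ (b - a) * t := mul_nonneg (by linarith) ht
  have h3 : 1 - (b - a) * t ≤ Real.exp (-((b - a) * t)) := by
    have := Real.add_one_le_exp (-((b - a) * t)); linarith
  have h4 : Real.exp (-((b - a) * t)) ≤ 1 := Real.exp_le_one_iff.2 (by linarith)
  have h5 := Real.exp_pos (-(a * t))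
  rw [h1, abs_of_nonneg (by nlinarith)]
  nlinarith

open Set in
lemma integrableOn_inv_mul_exp_sub_exp_of_le {a b : ℝ} (ha : 0 < a) (hab : a ≤ b) :
    IntegrableOn (fun t : ℝ => t⁻¹ * (Real.exp (-(a * t)) - Real.exp (-(b * t)))) (Ioi 0) := by
  have h := (integrableOn_exp_mul_Ioi (neg_lt_zero.2 ha) 0).const_mul (b - a)
  refine h.mono (by fun_prop) ?_
  filter_upwards [ae_restrict_mem measurableSet_Ioi] with t (ht : 0 < t)
  have h2 := abs_exp_neg_mul_sub_exp_neg_mul_le hab ht.le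
  have h3 : 0 ≤ b - a := by linarith
  rw [Real.norm_eq_abs, Real.norm_eq_abs, abs_mul, abs_mul, abs_of_nonneg h3,
    abs_of_pos (inv_pos.2 ht), abs_of_pos (Real.exp_pos _), inv_mul_le_iff₀ ht, neg_mul]
  linarith

open Set in
lemma integrableOn_inv_mul_exp_sub_exp {a b : ℝ} (ha : 0 < a) (hb : 0 < b) :
    IntegrableOn (fun t : ℝ => t⁻¹ * (Real.exp (-(a * t)) - Real.exp (-(b * t)))) (Ioi 0) := by
  rcases le_total a b with h | h
  · exact integrableOn_inv_mul_exp_sub_exp_of_le ha h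
  · refine (integrableOn_inv_mul_exp_sub_exp_of_le hb h).neg.congr ?_
    filter_upwards with t
    simp only [Pi.neg_apply]; ring

open Set Filter Topology in
lemma integral_inv_mul_exp_sub_exp {a b : ℝ} (ha : 0 < a) (hb : 0 < b) :
    ∫ t in Ioi (0 : ℝ), t⁻¹ * (Real.exp (-(a * t)) - Real.exp (-(b * t))) = Real.log (b / a) := by
  have := Frullani.integral_Ioi_eq (f := fun x : ℝ => Real.exp (-x)) (L := 1) (R := 0)
    (ContinuousOn.locallyIntegrableOn (by fun_prop) measurableSet_Ioi) ha hb
    (by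
      have : Tendsto (fun x : ℝ => Real.exp (-x)) (𝓝 0) (𝓝 (Real.exp (-0))) :=
        (by fun_prop : Continuous fun x : ℝ => Real.exp (-x)).tendsto 0
      simp only [neg_zero, Real.exp_zero] at this
      exact this.mono_left nhdsWithin_le_nhds)
    (Real.tendsto_exp_atBot.comp tendsto_neg_atTop_atBot)
    (integrableOn_inv_mul_exp_sub_exp ha hb)
  simpa using this

-- The integrand has constant sign, so its L¹ norm is the absolute value of Frullani's integral.
-- This exact norm turns integrability of the kernel into the integrability that Fubini needs.
open Set in
lemma integral_abs_inv_mul_exp_sub_exp {a b : ℝ} (ha : 0 < a) (hb : 0 < b) :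
    ∫ t in Ioi (0 : ℝ), ‖t⁻¹ * (Real.exp (-(a * t)) - Real.exp (-(b * t)))‖
      = |Real.log (b / a)| := by
  wlog hab : a ≤ b generalizing a b
  · have := this hb ha (le_of_not_ge hab)
    rw [← inv_div, Real.log_inv, abs_neg, ← this]
    congr 1; ext t
    rw [norm_mul, norm_mul, norm_sub_rev]
  rw [abs_of_nonneg (Real.log_nonneg ((one_le_div ha).2 hab)), ← integral_inv_mul_exp_sub_exp ha hb]
  refine setIntegral_congr_fun measurableSet_Ioi fun t (ht : 0 < t) => ?_
  rw [Real.norm_of_nonneg]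
  refine mul_nonneg (inv_pos.2 ht).le (sub_nonneg.2 (Real.exp_le_exp.2 ?_))
  have := mul_le_mul_of_nonneg_right hab ht.le
  linarith

lemma measurable_logKernel : Measurable (fun p : ℂ × ℂ => logKernel p.1 p.2) := by
  unfold logKernel; fun_prop

lemma logKernel_eq (z ζ : ℂ) : logKernel z ζ = -Real.log ‖z - ζ‖ := by
  rw [logKernel, Real.log_inv]

lemma ae_prod_ne {μ ν : Measure ℂ} [SFinite μ] [SFinite ν] (hν : ∀ z : ℂ, ν {z} = 0) :
    ∀ᵐ p ∂(μ.prod ν), p.1 ≠ p.2 := by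
  have hm : MeasurableSet {p : ℂ × ℂ | p.1 = p.2} := measurableSet_eq_fun measurable_fst measurable_snd
  rw [ae_iff]
  simp only [ne_eq, not_not]
  rw [Measure.measure_prod_null hm]
  filter_upwards with z
  have : Prod.mk z ⁻¹' {p : ℂ × ℂ | p.1 = p.2} = {z} := by ext w; simp [eq_comm]
  rw [this, hν]; rfl

/-- The Gaussian energy `∬ exp (-t |z - ζ|²) dμ dν`. -/
def gaussianEnergy (μ ν : Measure ℂ) (t : ℝ) : ℝ :=
  ∫ p, Real.exp (-(‖p.1 - p.2‖ ^ 2 * t)) ∂(μ.prod ν)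

section LogEnergy

variable {μ ν : Measure ℂ} [IsProbabilityMeasure μ] [IsProbabilityMeasure ν]

open Set in
lemma integrable_prod_inv_mul_exp_sub_exp (hν : ∀ z : ℂ, ν {z} = 0)
    (hi : Integrable (fun p : ℂ × ℂ => logKernel p.1 p.2) (μ.prod ν)) :
    Integrable (fun q : (ℂ × ℂ) × ℝ =>
      q.2⁻¹ * (Real.exp (-(‖q.1.1 - q.1.2‖ ^ 2 * q.2)) - Real.exp (-(1 * q.2))))
      ((μ.prod ν).prod (volume.restrict (Ioi 0))) := by
  have hpos : ∀ p : ℂ × ℂ, p.1 ≠ p.2 → 0 < ‖p.1 - p.2‖ ^ 2 := fun p hp =>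
    pow_pos (norm_pos_iff.2 (sub_ne_zero.2 hp)) 2
  rw [integrable_prod_iff (by fun_prop)]
  constructor
  · filter_upwards [ae_prod_ne (μ := μ) hν] with p hp
    exact integrableOn_inv_mul_exp_sub_exp (hpos p hp) one_pos
  · refine (hi.abs.const_mul 2).congr ?_
    filter_upwards [ae_prod_ne (μ := μ) hν] with p hp
    rw [integral_abs_inv_mul_exp_sub_exp (hpos p hp) one_pos, logKernel, one_div, Real.log_inv,
      Real.log_inv, Real.log_pow, abs_neg, abs_neg, abs_mul]
    simp

-- Fubini and Frullani's integral for the exponents `‖z - ζ‖ ^ 2` and `1`; the diagonal, where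
-- Frullani fails, is null since `ν` has no atoms.
open Set in
lemma logEnergy_eq_integral_gaussianEnergy (hν : ∀ z : ℂ, ν {z} = 0)
    (hi : Integrable (fun p : ℂ × ℂ => logKernel p.1 p.2) (μ.prod ν)) :
    IntegrableOn (fun t => t⁻¹ * (gaussianEnergy μ ν t - Real.exp (-t))) (Ioi 0) ∧
      ∫ t in Ioi (0 : ℝ), t⁻¹ * (gaussianEnergy μ ν t - Real.exp (-t))
        = 2 * ∫ p, logKernel p.1 p.2 ∂(μ.prod ν) := by
  have hint := integrable_prod_inv_mul_exp_sub_exp hν hi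
  have hE : ∀ t ∈ Ioi (0 : ℝ), ∫ p : ℂ × ℂ, t⁻¹ * (Real.exp (-(‖p.1 - p.2‖ ^ 2 * t))
      - Real.exp (-(1 * t))) ∂(μ.prod ν) = t⁻¹ * (gaussianEnergy μ ν t - Real.exp (-t)) := by
    intro t (ht : 0 < t)
    rw [integral_const_mul, integral_sub, gaussianEnergy]
    · simp
    · refine (integrable_const (1 : ℝ)).mono (by fun_prop) ?_
      filter_upwards with p
      rw [Real.norm_of_nonneg (Real.exp_pos _).le, norm_one]
      exact Real.exp_le_one_iff.2 (neg_nonpos.2 (by positivity))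
    · exact integrable_const _
  constructor
  · exact hint.integral_prod_right.congr
      ((ae_restrict_mem measurableSet_Ioi).mono fun t ht => hE t ht)
  · rw [← setIntegral_congr_fun measurableSet_Ioi hE, ← integral_const_mul]
    rw [← integral_integral_swap (f := fun (p : ℂ × ℂ) (t : ℝ) =>
      t⁻¹ * (Real.exp (-(‖p.1 - p.2‖ ^ 2 * t)) - Real.exp (-(1 * t)))) hint]
    refine integral_congr_ae ?_
    filter_upwards [ae_prod_ne (μ := μ) hν] with p hp
    have hpos : 0 < ‖p.1 - p.2‖ ^ 2 := pow_pos (norm_pos_iff.2 (sub_ne_zero.2 hp)) 2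
    rw [integral_inv_mul_exp_sub_exp hpos one_pos, logKernel, one_div, Real.log_inv,
      Real.log_inv, Real.log_pow]
    push_cast; ring

end LogEnergy

/-! ### Gaussian energies on the Fourier side -/

/-- A Gaussian is the Fourier transform of a positive Gaussian; this positive weight is the source
of all positivity below. -/
lemma exp_neg_norm_sq_eq_integral (x : ℂ) {t : ℝ} (ht : 0 < t) :
    (Real.exp (-(‖x‖ ^ 2 * t)) : ℂ) = ((4 * Real.pi * t)⁻¹ : ℝ) *
      ∫ ξ : ℂ, (Real.exp (-(4 * t)⁻¹ * ‖ξ‖ ^ 2) : ℂ) * Complex.exp ((inner ℝ x ξ : ℝ) * Complex.I) := by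
  have h := GaussianFourier.integral_cexp_neg_mul_sq_norm_add (V := ℂ) (b := ((4 * t)⁻¹ : ℝ))
    (by rw [Complex.ofReal_re]; positivity) Complex.I x
  have h1 : ∀ ξ : ℂ, (Real.exp (-(4 * t)⁻¹ * ‖ξ‖ ^ 2) : ℂ) *
      Complex.exp ((inner ℝ x ξ : ℝ) * Complex.I) =
      Complex.exp (-((4 * t)⁻¹ : ℝ) * (‖ξ‖ : ℂ) ^ 2 + Complex.I * (inner ℝ x ξ : ℝ)) := by
    intro ξ
    rw [Complex.exp_add, Complex.ofReal_exp]; push_cast; ring_nf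
  simp_rw [h1]
  rw [h, Complex.finrank_real_complex]
  have ht' : (t : ℂ) ≠ 0 := by exact_mod_cast ht.ne'
  have hpi : (Real.pi : ℂ) ≠ 0 := by exact_mod_cast Real.pi_ne_zero
  rw [Nat.cast_ofNat, div_self two_ne_zero, Complex.cpow_one, Complex.I_sq, ← mul_assoc,
    Complex.ofReal_exp]
  push_cast
  rw [show (4 * (Real.pi : ℂ) * t)⁻¹ * (Real.pi / (4 * t : ℂ)⁻¹) = 1 by field_simp, one_mul]
  congr 1
  field_simp

lemma norm_cexp_inner_mul_I (x ξ : ℂ) : ‖Complex.exp ((inner ℝ x ξ : ℝ) * Complex.I)‖ = 1 :=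
  Complex.norm_exp_ofReal_mul_I _

lemma integrable_exp_neg_mul_norm_sq {c : ℝ} (hc : 0 < c) :
    Integrable (fun ξ : ℂ => Real.exp (-c * ‖ξ‖ ^ 2)) := by
  have h := GaussianFourier.integrable_cexp_neg_mul_sq_norm_add (V := ℂ) (b := (c : ℂ))
    (by simpa using hc) 0 0
  refine h.norm.congr (ae_of_all _ fun ξ => ?_)
  simp only [Complex.norm_exp]
  congr 1
  simp [← Complex.ofReal_pow]

section GaussianEnergy

variable {μ ν : Measure ℂ} [IsProbabilityMeasure μ] [IsProbabilityMeasure ν]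

lemma gaussianEnergy_eq_integral_charFun {t : ℝ} (ht : 0 < t) :
    (gaussianEnergy μ ν t : ℂ) = ((4 * Real.pi * t)⁻¹ : ℝ) *
      ∫ ξ : ℂ, (Real.exp (-(4 * t)⁻¹ * ‖ξ‖ ^ 2) : ℂ) *
        (charFun μ ξ * (starRingEnd ℂ) (charFun ν ξ)) := by
  have ht4 : 0 < (4 * t)⁻¹ := by positivity
  rw [gaussianEnergy, ← integral_complex_ofReal]
  simp_rw [exp_neg_norm_sq_eq_integral _ ht]
  rw [integral_const_mul, integral_integral_swap]
  · congr 1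
    refine integral_congr_ae (ae_of_all _ fun ξ => ?_)
    beta_reduce
    rw [integral_const_mul]
    congr 1
    -- The character at `p.1 - p.2` is a product of characters, so the double integral splits.
    rw [← charFun_neg, charFun_apply, charFun_apply, ← integral_prod_mul]
    refine integral_congr_ae (ae_of_all _ fun p => ?_)
    beta_reduce
    rw [← Complex.exp_add, inner_sub_left, inner_neg_right]
    push_cast; ring_nf
  · have h1 : Integrable (fun q : (ℂ × ℂ) × ℂ => (1 : ℝ) * Real.exp (-(4 * t)⁻¹ * ‖q.2‖ ^ 2))
        ((μ.prod ν).prod volume) :=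
      Integrable.mul_prod (integrable_const (1 : ℝ)) (integrable_exp_neg_mul_norm_sq ht4)
    refine h1.mono ?_ (ae_of_all _ fun q => ?_)
    · refine Continuous.aestronglyMeasurable ?_
      rw [Function.uncurry_def]
      fun_prop
    · rw [Function.uncurry_def]
      rw [norm_mul, norm_cexp_inner_mul_I, mul_one, one_mul, Complex.norm_real]

lemma integrable_exp_mul_charFun_mul_charFun {c : ℝ} (hc : 0 < c) :
    Integrable (fun ξ : ℂ => (Real.exp (-c * ‖ξ‖ ^ 2) : ℂ) *
        (charFun μ ξ * (starRingEnd ℂ) (charFun ν ξ))) := by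
  refine (integrable_exp_neg_mul_norm_sq hc).mono ?_ (ae_of_all _ fun ξ => ?_)
  · have := continuous_charFun (μ := μ)
    have := continuous_charFun (μ := ν)
    exact Continuous.aestronglyMeasurable (by fun_prop)
  · rw [norm_mul, norm_mul, Complex.norm_real, RCLike.norm_conj]
    have h1 := norm_charFun_le_one (μ := μ) (t := ξ)
    have h2 := norm_charFun_le_one (μ := ν) (t := ξ)
    have h3 := mul_le_one₀ h1 (norm_nonneg _) h2
    exact mul_le_of_le_one_right (norm_nonneg _) h3

lemma gaussianEnergy_comm (t : ℝ) : gaussianEnergy μ ν t = gaussianEnergy ν μ t := by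
  rw [gaussianEnergy, gaussianEnergy, ← integral_prod_swap]
  refine integral_congr_ae (ae_of_all _ fun p => ?_)
  simp only [Prod.fst_swap, Prod.snd_swap]
  rw [norm_sub_rev]

lemma gaussianEnergy_sub_sub {t : ℝ} (ht : 0 < t) :
    gaussianEnergy μ μ t + gaussianEnergy ν ν t - 2 * gaussianEnergy μ ν t =
      (4 * Real.pi * t)⁻¹ *
        ∫ ξ : ℂ, Real.exp (-(4 * t)⁻¹ * ‖ξ‖ ^ 2) * ‖charFun μ ξ - charFun ν ξ‖ ^ 2 := by
  have ht4 : 0 < (4 * t)⁻¹ := by positivity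
  have h : gaussianEnergy μ μ t + gaussianEnergy ν ν t - 2 * gaussianEnergy μ ν t =
    (gaussianEnergy μ μ t + gaussianEnergy ν ν t) - (gaussianEnergy μ ν t + gaussianEnergy ν μ t) := by
    rw [gaussianEnergy_comm (μ := ν) (ν := μ)]; ring
  rw [h, ← Complex.ofReal_inj]
  push_cast
  rw [gaussianEnergy_eq_integral_charFun ht, gaussianEnergy_eq_integral_charFun ht,
    gaussianEnergy_eq_integral_charFun ht, gaussianEnergy_eq_integral_charFun ht,
    ← integral_complex_ofReal, ← mul_add, ← mul_add, ← mul_sub,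
    ← integral_add, ← integral_add, ← integral_sub]
  · push_cast
    congr 1
    refine integral_congr_ae (ae_of_all _ fun ξ => ?_)
    have h := Complex.mul_conj' (charFun μ ξ - charFun ν ξ)
    rw [map_sub] at h
    beta_reduce
    rw [← h]
    ring
  all_goals first
    | exact integrable_exp_mul_charFun_mul_charFun ht4
    | exact (integrable_exp_mul_charFun_mul_charFun ht4).add
        (integrable_exp_mul_charFun_mul_charFun ht4)

lemma integrable_exp_mul_norm_charFun_sub_sq {c : ℝ} (hc : 0 < c) :
    Integrable (fun ξ : ℂ => Real.exp (-c * ‖ξ‖ ^ 2) * ‖charFun μ ξ - charFun ν ξ‖ ^ 2) := by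
  refine ((integrable_exp_neg_mul_norm_sq hc).mul_const 4).mono ?_ (ae_of_all _ fun ξ => ?_)
  · have := continuous_charFun (μ := μ)
    have := continuous_charFun (μ := ν)
    exact Continuous.aestronglyMeasurable (by fun_prop)
  · rw [norm_mul, norm_mul]
    refine mul_le_mul_of_nonneg_left ?_ (norm_nonneg _)
    have h1 := norm_charFun_le_one (μ := μ) (t := ξ)
    have h2 := norm_charFun_le_one (μ := ν) (t := ξ)
    have h3 := norm_sub_le (charFun μ ξ) (charFun ν ξ)
    have h4 := norm_nonneg (charFun μ ξ - charFun ν ξ)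
    rw [norm_pow, norm_norm, Real.norm_eq_abs, abs_of_pos (by norm_num : (0 : ℝ) < 4)]
    nlinarith

lemma gaussianEnergy_sub_sub_nonneg {t : ℝ} (ht : 0 < t) :
    0 ≤ gaussianEnergy μ μ t + gaussianEnergy ν ν t - 2 * gaussianEnergy μ ν t := by
  rw [gaussianEnergy_sub_sub ht]
  exact mul_nonneg (by positivity) (integral_nonneg fun ξ => by positivity)

/-- A single `t` suffices: the Gaussian weight vanishes nowhere, so the continuous characteristic
functions agree at every frequency. -/
lemma eq_of_gaussianEnergy_sub_sub_eq_zero {t : ℝ} (ht : 0 < t)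
    (h : gaussianEnergy μ μ t + gaussianEnergy ν ν t - 2 * gaussianEnergy μ ν t = 0) : μ = ν := by
  have ht4 : 0 < (4 * t)⁻¹ := by positivity
  rw [gaussianEnergy_sub_sub ht, mul_eq_zero, or_iff_right (by positivity),
    integral_eq_zero_iff_of_nonneg (fun ξ => by positivity)
      (integrable_exp_mul_norm_charFun_sub_sq ht4)] at h
  have hc1 := continuous_charFun (μ := μ)
  have hc2 := continuous_charFun (μ := ν)
  have h2 := (Continuous.ae_eq_iff_eq volume (by fun_prop) continuous_const).1 h
  refine Measure.ext_of_charFun (funext fun ξ => ?_)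
  have h3 : Real.exp (-(4 * t)⁻¹ * ‖ξ‖ ^ 2) * ‖charFun μ ξ - charFun ν ξ‖ ^ 2 = 0 := congrFun h2 ξ
  rw [mul_eq_zero, or_iff_right (Real.exp_pos _).ne'] at h3
  exact sub_eq_zero.1 (norm_eq_zero.1 (pow_eq_zero_iff two_ne_zero |>.1 h3))

end GaussianEnergy

/-! ### Positive definiteness of the logarithmic energy -/

section Positivity

variable {μ ν : Measure ℂ} [IsProbabilityMeasure μ] [IsProbabilityMeasure ν]

open Set in
lemma integral_gaussianEnergy_sub_sub (hμ : ∀ z : ℂ, μ {z} = 0) (hν : ∀ z : ℂ, ν {z} = 0)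
    (hμμ : Integrable (fun p : ℂ × ℂ => logKernel p.1 p.2) (μ.prod μ))
    (hνν : Integrable (fun p : ℂ × ℂ => logKernel p.1 p.2) (ν.prod ν))
    (hμν : Integrable (fun p : ℂ × ℂ => logKernel p.1 p.2) (μ.prod ν)) :
    IntegrableOn (fun t => t⁻¹ *
      (gaussianEnergy μ μ t + gaussianEnergy ν ν t - 2 * gaussianEnergy μ ν t)) (Ioi 0) ∧
    ∫ t in Ioi (0 : ℝ), t⁻¹ *
      (gaussianEnergy μ μ t + gaussianEnergy ν ν t - 2 * gaussianEnergy μ ν t) =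
    2 * (∫ p, logKernel p.1 p.2 ∂(μ.prod μ) + ∫ p, logKernel p.1 p.2 ∂(ν.prod ν)
      - 2 * ∫ p, logKernel p.1 p.2 ∂(μ.prod ν)) := by
  obtain ⟨i1, e1⟩ := logEnergy_eq_integral_gaussianEnergy hμ hμμ
  obtain ⟨i2, e2⟩ := logEnergy_eq_integral_gaussianEnergy hν hνν
  obtain ⟨i3, e3⟩ := logEnergy_eq_integral_gaussianEnergy hν hμν
  have h : (fun t => t⁻¹ *
      (gaussianEnergy μ μ t + gaussianEnergy ν ν t - 2 * gaussianEnergy μ ν t)) = fun t =>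
      (t⁻¹ * (gaussianEnergy μ μ t - Real.exp (-t)) + t⁻¹ * (gaussianEnergy ν ν t - Real.exp (-t)))
      - 2 * (t⁻¹ * (gaussianEnergy μ ν t - Real.exp (-t))) := by ext t; ring
  rw [h]
  refine ⟨(i1.add i2).sub (i3.const_mul 2), ?_⟩
  have e12 := integral_add i1 i2
  refine (integral_sub (i1.add i2) (i3.const_mul 2)).trans ?_
  simp only [Pi.add_apply]
  rw [e12, integral_const_mul, e1, e2, e3]
  ring

open Set in
/-- The logarithmic energy is nonnegative on differences of probability measures. -/
theorem logEnergy_sub_nonneg (hμ : ∀ z : ℂ, μ {z} = 0) (hν : ∀ z : ℂ, ν {z} = 0)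
    (hμμ : Integrable (fun p : ℂ × ℂ => logKernel p.1 p.2) (μ.prod μ))
    (hνν : Integrable (fun p : ℂ × ℂ => logKernel p.1 p.2) (ν.prod ν))
    (hμν : Integrable (fun p : ℂ × ℂ => logKernel p.1 p.2) (μ.prod ν)) :
    0 ≤ ∫ p, logKernel p.1 p.2 ∂(μ.prod μ) + ∫ p, logKernel p.1 p.2 ∂(ν.prod ν)
      - 2 * ∫ p, logKernel p.1 p.2 ∂(μ.prod ν) := by
  have h := (integral_gaussianEnergy_sub_sub hμ hν hμμ hνν hμν).2
  have h2 := setIntegral_nonneg (μ := volume) (measurableSet_Ioi (a := (0 : ℝ)))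
    fun t (ht : 0 < t) => mul_nonneg (inv_pos.2 ht).le
      (gaussianEnergy_sub_sub_nonneg (μ := μ) (ν := ν) ht)
  linarith

open Set in
/-- The logarithmic energy is definite on differences of probability measures. -/
theorem eq_of_logEnergy_sub_eq_zero (hμ : ∀ z : ℂ, μ {z} = 0) (hν : ∀ z : ℂ, ν {z} = 0)
    (hμμ : Integrable (fun p : ℂ × ℂ => logKernel p.1 p.2) (μ.prod μ))
    (hνν : Integrable (fun p : ℂ × ℂ => logKernel p.1 p.2) (ν.prod ν))
    (hμν : Integrable (fun p : ℂ × ℂ => logKernel p.1 p.2) (μ.prod ν))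
    (h0 : ∫ p, logKernel p.1 p.2 ∂(μ.prod μ) + ∫ p, logKernel p.1 p.2 ∂(ν.prod ν)
      - 2 * ∫ p, logKernel p.1 p.2 ∂(μ.prod ν) = 0) : μ = ν := by
  obtain ⟨hi, h⟩ := integral_gaussianEnergy_sub_sub hμ hν hμμ hνν hμν
  rw [h0, mul_zero, setIntegral_eq_zero_iff_of_nonneg_ae
    ((ae_restrict_mem measurableSet_Ioi).mono fun t ht => mul_nonneg (inv_pos.2 ht).le
      (gaussianEnergy_sub_sub_nonneg (μ := μ) (ν := ν) ht)) hi] at h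
  have : (volume.restrict (Ioi (0 : ℝ))) ≠ 0 := by simp
  have : NeZero (volume.restrict (Ioi (0 : ℝ))) := ⟨this⟩
  obtain ⟨t, ht, h2⟩ := ((ae_restrict_mem measurableSet_Ioi).and h).exists
  have ht' : (0 : ℝ) < t := ht
  -- The nonnegative integrand vanishes for almost every `t > 0`; one such `t` is enough.
  refine eq_of_gaussianEnergy_sub_sub_eq_zero ht' ?_
  simpa [ht'.ne'] using h2

end Positivity

/-! ### Homothetic ellipses and the Joukowski map -/

/-- The square of the Minkowski functional of the ellipse with semi-axes `α + β`, `α - β`. -/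
def ellipseLevel (α β : ℝ) (z : ℂ) : ℝ := z.re ^ 2 / (α + β) ^ 2 + z.im ^ 2 / (α - β) ^ 2

/-- The principal square root of `1 - 4αβu/z²`. -/
def discrSqrt (α β : ℝ) (z u : ℂ) : ℂ := (1 - 4 * α * β / z ^ 2 * u) ^ (2⁻¹ : ℂ)

/-- The root of largest modulus of `h² - z h + αβ r²`. -/
def joukowskiRoot (α β : ℝ) (z : ℂ) (r : ℝ) : ℂ := z * (1 + discrSqrt α β z (r ^ 2 : ℝ)) / 2

/-- The Green function with pole at infinity of the exterior of the ellipse with semi-axes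
`(α + β) r`, `(α - β) r`. -/
def ellipseGreen (α β : ℝ) (z : ℂ) (r : ℝ) : ℝ := Real.posLog (‖joukowskiRoot α β z r‖ / (α * r))

section Root

variable {α β : ℝ} {z : ℂ} {r : ℝ}

lemma discrSqrt_sq (u : ℂ) : discrSqrt α β z u ^ 2 = 1 - 4 * α * β / z ^ 2 * u := by
  simp [discrSqrt]

lemma discrSqrt_re_nonneg (u : ℂ) : 0 ≤ (discrSqrt α β z u).re := by
  rw [discrSqrt, Complex.cpow_inv_two_re]; positivity

lemma one_add_discrSqrt_mem_slitPlane (u : ℂ) : 1 + discrSqrt α β z u ∈ Complex.slitPlane := by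
  left
  have := discrSqrt_re_nonneg (α := α) (β := β) (z := z) u
  simp only [Complex.add_re, Complex.one_re]; linarith

lemma one_add_discrSqrt_ne_zero (u : ℂ) : 1 + discrSqrt α β z u ≠ 0 :=
  Complex.slitPlane_ne_zero (one_add_discrSqrt_mem_slitPlane u)

lemma joukowskiRoot_ne_zero (hz : z ≠ 0) : joukowskiRoot α β z r ≠ 0 :=
  div_ne_zero (mul_ne_zero hz (one_add_discrSqrt_ne_zero _)) two_ne_zero

lemma joukowskiRoot_zero : joukowskiRoot α β 0 r = 0 := by simp [joukowskiRoot]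

lemma joukowskiRoot_mul_sub (hz : z ≠ 0) :
    joukowskiRoot α β z r * (z - joukowskiRoot α β z r) = α * β * r ^ 2 := by
  have h := discrSqrt_sq (α := α) (β := β) (z := z) (r ^ 2 : ℝ)
  rw [joukowskiRoot]
  have e : z * (1 + discrSqrt α β z (r ^ 2 : ℝ)) / 2 * (z - z * (1 + discrSqrt α β z (r ^ 2 : ℝ)) / 2)
    = z ^ 2 * (1 - discrSqrt α β z (r ^ 2 : ℝ) ^ 2) / 4 := by ring
  rw [e, h]
  push_cast
  field_simp
  ring

/-- The principal square root `q` has nonnegative real part, so `|1 - q| ≤ |1 + q|`. -/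
lemma norm_sub_joukowskiRoot_le : ‖z - joukowskiRoot α β z r‖ ≤ ‖joukowskiRoot α β z r‖ := by
  have h := discrSqrt_re_nonneg (α := α) (β := β) (z := z) (r ^ 2 : ℝ)
  rw [joukowskiRoot]
  set q := discrSqrt α β z (r ^ 2 : ℝ)
  rw [show z - z * (1 + q) / 2 = z * (1 - q) / 2 by ring]
  rw [norm_div, norm_div, norm_mul, norm_mul]
  gcongr
  rw [← sq_le_sq₀ (norm_nonneg _) (norm_nonneg _), Complex.sq_norm, Complex.sq_norm,
    Complex.normSq_apply, Complex.normSq_apply]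
  simp only [Complex.sub_re, Complex.one_re, Complex.sub_im, Complex.one_im, Complex.add_re,
    Complex.add_im]
  nlinarith

lemma norm_joukowskiRoot_mul (hα : 0 < α) (hβ : 0 ≤ β) (hz : z ≠ 0) :
    ‖joukowskiRoot α β z r‖ * ‖z - joukowskiRoot α β z r‖ = α * β * r ^ 2 := by
  rw [← norm_mul, joukowskiRoot_mul_sub hz]
  have : ((α : ℂ) * β * r ^ 2) = ((α * β * r ^ 2 : ℝ) : ℂ) := by push_cast; ring
  rw [this, Complex.norm_real, Real.norm_of_nonneg (by positivity)]

end Root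

section Level

variable {α β : ℝ} {z h : ℂ} {r : ℝ}

/-- Since `z = h + (αβr² / |h|²) conj h`, the point lies on an ellipse with semi-axes `|h| ± αβr² /
|h|`. The level is thus a convex combination of two squares, each of which is compared with `r²`
below. -/
lemma ellipseLevel_eq_of_root (hh : h ≠ 0) (hz : h * (z - h) = α * β * r ^ 2) :
    ellipseLevel α β z =
      h.re ^ 2 / ‖h‖ ^ 2 * ((‖h‖ + α * β * r ^ 2 / ‖h‖) / (α + β)) ^ 2 +
      h.im ^ 2 / ‖h‖ ^ 2 * ((‖h‖ - α * β * r ^ 2 / ‖h‖) / (α - β)) ^ 2 := by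
  have hm : 0 < ‖h‖ := norm_pos_iff.2 hh
  have e : z = h + ((α * β * r ^ 2 / ‖h‖ ^ 2 : ℝ) : ℂ) * (starRingEnd ℂ) h := by
    have h1 := Complex.mul_conj' h
    have hm' : (‖h‖ : ℂ) ≠ 0 := by exact_mod_cast hm.ne'
    apply mul_left_cancel₀ hh
    push_cast
    rw [show h * (h + α * β * r ^ 2 / (‖h‖ : ℂ) ^ 2 * (starRingEnd ℂ) h) = h * h +
      α * β * r ^ 2 / (‖h‖ : ℂ) ^ 2 * (h * (starRingEnd ℂ) h) by ring, h1, div_mul_cancel₀ _ (by positivity), ← hz]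
    ring
  have hre : z.re = h.re * (1 + α * β * r ^ 2 / ‖h‖ ^ 2) := by
    conv_lhs => rw [e]
    simp only [Complex.add_re, Complex.re_ofReal_mul, Complex.conj_re]; ring
  have him : z.im = h.im * (1 - α * β * r ^ 2 / ‖h‖ ^ 2) := by
    conv_lhs => rw [e]
    simp only [Complex.add_im, Complex.im_ofReal_mul, Complex.conj_im]; ring
  rw [ellipseLevel, hre, him]
  congr 1 <;> · field_simp

variable (hβ : 0 ≤ β) (hαβ : β < α)
include hβ hαβ

lemma lt_ellipseLevel_of_root (hr : 0 < r) (hh : h ≠ 0) (hz : h * (z - h) = α * β * r ^ 2)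
    (hlt : α * r < ‖h‖) : r ^ 2 < ellipseLevel α β z := by
  have hm : 0 < ‖h‖ := norm_pos_iff.2 hh
  have hsq : h.re ^ 2 / ‖h‖ ^ 2 + h.im ^ 2 / ‖h‖ ^ 2 = 1 := by
    rw [← add_div, div_eq_one_iff_eq (by positivity), Complex.sq_norm, Complex.normSq_apply]; ring
  have hβr : β * r < ‖h‖ := by nlinarith
  rw [ellipseLevel_eq_of_root hh hz]
  have hX : r < (‖h‖ + α * β * r ^ 2 / ‖h‖) / (α + β) := by
    rw [lt_div_iff₀ (by linarith), ← sub_pos]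
    have : ‖h‖ + α * β * r ^ 2 / ‖h‖ - r * (α + β) = (‖h‖ - α * r) * (‖h‖ - β * r) / ‖h‖ := by
      field_simp; ring
    rw [this]
    exact div_pos (mul_pos (by linarith) (by linarith)) hm
  have hY : r < (‖h‖ - α * β * r ^ 2 / ‖h‖) / (α - β) := by
    rw [lt_div_iff₀ (by linarith), ← sub_pos]
    have : ‖h‖ - α * β * r ^ 2 / ‖h‖ - r * (α - β) = (‖h‖ - α * r) * (‖h‖ + β * r) / ‖h‖ := by
      field_simp; ring
    rw [this]
    exact div_pos (mul_pos (by linarith) (by positivity)) hm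
  have hX2 := pow_lt_pow_left₀ hX hr.le two_ne_zero
  have hY2 := pow_lt_pow_left₀ hY hr.le two_ne_zero
  have p0 : 0 ≤ h.re ^ 2 / ‖h‖ ^ 2 := by positivity
  have q0 : 0 ≤ h.im ^ 2 / ‖h‖ ^ 2 := by positivity
  generalize h.re ^ 2 / ‖h‖ ^ 2 = p at *
  generalize h.im ^ 2 / ‖h‖ ^ 2 = q at *
  rcases p0.eq_or_lt with rfl | hp
  · rw [zero_add] at hsq; rw [hsq]; linarith
  · nlinarith [mul_pos hp (sub_pos.2 hX2), mul_nonneg q0 (sub_pos.2 hY2).le]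

lemma ellipseLevel_lt_of_root (hr : 0 < r) (hh : h ≠ 0) (hz : h * (z - h) = α * β * r ^ 2)
    (hle : ‖z - h‖ ≤ ‖h‖) (hlt : ‖h‖ < α * r) : ellipseLevel α β z < r ^ 2 := by
  have hm : 0 < ‖h‖ := norm_pos_iff.2 hh
  have hα : 0 < α := by linarith
  have hsq : h.re ^ 2 / ‖h‖ ^ 2 + h.im ^ 2 / ‖h‖ ^ 2 = 1 := by
    rw [← add_div, div_eq_one_iff_eq (by positivity), Complex.sq_norm, Complex.normSq_apply]; ring
  have hprod : ‖h‖ * ‖z - h‖ = α * β * r ^ 2 := by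
    rw [← norm_mul, hz]
    have : ((α : ℂ) * β * r ^ 2) = ((α * β * r ^ 2 : ℝ) : ℂ) := by push_cast; ring
    rw [this, Complex.norm_real, Real.norm_of_nonneg (by positivity)]
  -- Being the larger root keeps `‖h‖` above `β * r`, which the factor `‖h‖ - β * r` below requires.
  have hsqle : α * β * r ^ 2 ≤ ‖h‖ ^ 2 := by nlinarith
  have hβr : β * r < ‖h‖ := by
    rcases hβ.eq_or_lt with h0 | h0
    · rw [← h0, zero_mul]; exact hm
    · refine lt_of_pow_lt_pow_left₀ 2 hm.le (lt_of_lt_of_le ?_ hsqle)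
      have : 0 < β * r ^ 2 := by positivity
      nlinarith
  rw [ellipseLevel_eq_of_root hh hz]
  have hX : (‖h‖ + α * β * r ^ 2 / ‖h‖) / (α + β) < r := by
    rw [div_lt_iff₀ (by linarith), ← sub_pos]
    have : r * (α + β) - (‖h‖ + α * β * r ^ 2 / ‖h‖) = (α * r - ‖h‖) * (‖h‖ - β * r) / ‖h‖ := by
      field_simp; ring
    rw [this]
    exact div_pos (mul_pos (by linarith) (by linarith)) hm
  have hY : (‖h‖ - α * β * r ^ 2 / ‖h‖) / (α - β) < r := by
    rw [div_lt_iff₀ (by linarith), ← sub_pos]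
    have : r * (α - β) - (‖h‖ - α * β * r ^ 2 / ‖h‖) = (α * r - ‖h‖) * (‖h‖ + β * r) / ‖h‖ := by
      field_simp; ring
    rw [this]
    exact div_pos (mul_pos (by linarith) (by positivity)) hm
  have hX0 : 0 ≤ (‖h‖ + α * β * r ^ 2 / ‖h‖) / (α + β) := div_nonneg (by positivity) (by linarith)
  have hY0 : 0 ≤ (‖h‖ - α * β * r ^ 2 / ‖h‖) / (α - β) := by
    refine div_nonneg (sub_nonneg.2 ?_) (by linarith)
    rw [div_le_iff₀ hm]; linarith
  have hX2 := pow_lt_pow_left₀ hX hX0 two_ne_zero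
  have hY2 := pow_lt_pow_left₀ hY hY0 two_ne_zero
  have p0 : 0 ≤ h.re ^ 2 / ‖h‖ ^ 2 := by positivity
  have q0 : 0 ≤ h.im ^ 2 / ‖h‖ ^ 2 := by positivity
  generalize h.re ^ 2 / ‖h‖ ^ 2 = p at *
  generalize h.im ^ 2 / ‖h‖ ^ 2 = q at *
  rcases p0.eq_or_lt with rfl | hp
  · rw [zero_add] at hsq; rw [hsq]; linarith
  · nlinarith [mul_pos hp (sub_pos.2 hX2), mul_nonneg q0 (sub_pos.2 hY2).le]

lemma norm_joukowskiRoot_le (hz : z ≠ 0) (hr : 0 < r) (h : ellipseLevel α β z ≤ r ^ 2) :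
    ‖joukowskiRoot α β z r‖ ≤ α * r := by
  by_contra! hlt
  exact absurd (lt_ellipseLevel_of_root hβ hαβ hr (joukowskiRoot_ne_zero hz)
    (joukowskiRoot_mul_sub hz) hlt) (not_lt.2 h)

lemma le_norm_joukowskiRoot (hz : z ≠ 0) (hr : 0 < r) (h : r ^ 2 ≤ ellipseLevel α β z) :
    α * r ≤ ‖joukowskiRoot α β z r‖ := by
  by_contra! hlt
  exact absurd (ellipseLevel_lt_of_root hβ hαβ hr (joukowskiRoot_ne_zero hz)
    (joukowskiRoot_mul_sub hz) norm_sub_joukowskiRoot_le hlt) (not_lt.2 h)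

lemma ellipseGreen_eq_zero (hr : 0 < r) (h : ellipseLevel α β z ≤ r ^ 2) :
    ellipseGreen α β z r = 0 := by
  have hα : 0 < α := by linarith
  rw [ellipseGreen, Real.posLog_eq_zero_iff, abs_of_nonneg (by positivity),
    div_le_one (by positivity)]
  by_cases hz : z = 0
  · rw [hz, joukowskiRoot_zero, norm_zero]; positivity
  · exact norm_joukowskiRoot_le hβ hαβ hz hr h

lemma ellipseGreen_eq_log (hz : z ≠ 0) (hr : 0 < r) (h : r ^ 2 ≤ ellipseLevel α β z) :
    ellipseGreen α β z r = Real.log (‖joukowskiRoot α β z r‖ / (α * r)) := by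
  have hα : 0 < α := by linarith
  refine Real.posLog_eq_log ?_
  rw [abs_of_nonneg (by positivity), one_le_div (by positivity)]
  exact le_norm_joukowskiRoot hβ hαβ hz hr h

/-- The square root meets its cut only for `z` on the segment between the foci `±2 √(αβ) r`. This
segment lies strictly inside the ellipse of parameter `r`, because `4αβ < (α + β)²`. -/
lemma slitPlane_of_sq_le_level (hz : z ≠ 0) (h : r ^ 2 ≤ ellipseLevel α β z) :
    1 - 4 * α * β / z ^ 2 * (r ^ 2 : ℝ) ∈ Complex.slitPlane := by
  have hα : 0 < α := by linarith
  by_contra hn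
  rw [Complex.mem_slitPlane_iff, not_or, not_lt, not_not] at hn
  obtain ⟨h1, h2⟩ := hn
  set w := 4 * α * β / z ^ 2 * ((r ^ 2 : ℝ) : ℂ) with hw
  simp only [Complex.sub_re, Complex.one_re, Complex.sub_im, Complex.one_im, zero_sub,
    neg_eq_zero] at h1 h2
  have hwre : (w.re : ℂ) = w := by
    apply Complex.ext <;> simp [h2]
  have hz2 : z ^ 2 * w.re = ((4 * α * β * r ^ 2 : ℝ) : ℂ) := by
    rw [hwre, hw]; push_cast; field_simp
  have hre := congrArg Complex.re hz2
  have him := congrArg Complex.im hz2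
  rw [Complex.re_mul_ofReal, Complex.ofReal_re, sq] at hre
  rw [Complex.im_mul_ofReal, Complex.ofReal_im, sq] at him
  simp only [Complex.mul_re, Complex.mul_im] at hre him
  have hw1 : 1 ≤ w.re := by linarith
  have hpr : 0 ≤ α * β * r ^ 2 := by positivity
  have him' : z.re = 0 ∨ z.im = 0 := by
    have : z.re * z.im = 0 := by
      rcases mul_eq_zero.1 him with h | h
      · linarith
      · linarith
    exact mul_eq_zero.1 this
  have hne : z.re ^ 2 + z.im ^ 2 ≠ 0 := by
    intro h0
    apply hz
    apply Complex.ext <;> simp <;> nlinarith [sq_nonneg z.re, sq_nonneg z.im]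
  rcases him' with h0 | h0
  · rw [h0] at hre hne
    have : 0 < z.im ^ 2 :=
      lt_of_le_of_ne (sq_nonneg _) (by intro h'; apply hne; rw [← h']; ring)
    nlinarith
  · rw [h0] at hre hne
    have hx : 0 < z.re ^ 2 := lt_of_le_of_ne (sq_nonneg _) (by intro h'; apply hne; rw [← h']; ring)
    have hx2 : z.re ^ 2 ≤ 4 * α * β * r ^ 2 := by nlinarith
    rw [ellipseLevel, h0] at h
    have h3 : r ^ 2 * (α + β) ^ 2 ≤ z.re ^ 2 := by
      rw [← le_div_iff₀ (by positivity)]; simpa using h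
    have hr2 : 0 < r ^ 2 := by
      rcases (sq_nonneg r).eq_or_lt with h' | h'
      · rw [← h'] at hx2; linarith
      · exact h'
    have : 0 < r ^ 2 * (α - β) ^ 2 := mul_pos hr2 (pow_pos (by linarith) 2)
    nlinarith

end Level

/-! ### Logarithmic means over ellipses -/

open Filter in
/-- The mean of the logarithm of a product of two linear factors with prescribed absolute value
over a circle centred at the origin. -/
lemma circleAverage_log_mul_sub_mul_sub {f : ℂ → ℝ} {c r : ℝ} {p q : ℂ} (hr : 0 < r) (hc : 0 < c)
    (hf : ∀ w : ℂ, ‖w‖ = r → f w = Real.log (c * (‖w - p‖ * ‖w - q‖))) :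
    Real.circleAverage f 0 r =
      Real.log c + (Real.log r + Real.posLog (‖p‖ / r)) + (Real.log r + Real.posLog (‖q‖ / r)) := by
  -- The logarithm of the product splits only away from `p` and `q`, since `Real.log 0 = 0`; circle
  -- averages ignore such a finite set.
  have hco : f =ᶠ[codiscreteWithin (Metric.sphere (0 : ℂ) |r|)]
      (fun w => Real.log c + Real.log ‖w - p‖ + Real.log ‖w - q‖) := by
    have : ({p, q} : Set ℂ)ᶜ ∈ codiscreteWithin (Metric.sphere (0 : ℂ) |r|) := by
      apply codiscreteWithin_iff_locallyFiniteComplementWithin.2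
      intro z hz
      refine ⟨Set.univ, univ_mem, ?_⟩
      exact (Set.toFinite ({p, q} : Set ℂ)).subset (by intro x; simp)
    filter_upwards [this, self_mem_codiscreteWithin _] with w hw hws
    have hp : ‖w - p‖ ≠ 0 := norm_ne_zero_iff.2 (sub_ne_zero.2 fun h => hw (by simp [h]))
    have hq : ‖w - q‖ ≠ 0 := norm_ne_zero_iff.2 (sub_ne_zero.2 fun h => hw (by simp [h]))
    rw [hf w (by simpa [abs_of_pos hr] using hws), Real.log_mul hc.ne' (mul_ne_zero hp hq),
      Real.log_mul hp hq, add_assoc]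
  have i1 : CircleIntegrable (fun w : ℂ => Real.log c + Real.log ‖w - p‖) 0 r :=
    (circleIntegrable_const _ _ _).add (circleIntegrable_log_norm_sub_const r)
  have i2 : CircleIntegrable (fun w : ℂ => Real.log ‖w - q‖) 0 r :=
    circleIntegrable_log_norm_sub_const r
  rw [Real.circleAverage_congr_codiscreteWithin hco hr.ne', Real.circleAverage_fun_add i1 i2,
    Real.circleAverage_fun_add (circleIntegrable_const _ _ _)
      (circleIntegrable_log_norm_sub_const r), Real.circleAverage_const,
    circleAverage_log_norm_sub_const_eq_log_radius_add_posLog hr.ne',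
    circleAverage_log_norm_sub_const_eq_log_radius_add_posLog hr.ne']
  simp only [zero_sub, norm_neg, div_eq_inv_mul]

section Average

variable {α β : ℝ} {z : ℂ} {r : ℝ} (hβ : 0 ≤ β) (hαβ : β < α)
include hβ hαβ

/-- The mean over a confocal ellipse of the logarithmic kernel. -/
lemma circleAverage_log_norm_sub_ellipse (hr : 0 < r) :
    Real.circleAverage (fun w => Real.log ‖z - (α * w + β * (starRingEnd ℂ) w)‖) 0 r =
      Real.log α + Real.log r + ellipseGreen α β z r := by
  have hα : 0 < α := by linarith
  have hαc : (α : ℂ) ≠ 0 := by exact_mod_cast hα.ne'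
  obtain ⟨p, q, hpq, hmul, hq, hp⟩ : ∃ p q : ℂ, p + q = z ∧ p * q = α * β * r ^ 2 ∧ ‖q‖ ≤ α * r ∧
      Real.posLog (‖p / α‖ / r) = ellipseGreen α β z r := by
    -- At `z = 0` division by zero makes `joukowskiRoot` equal to `0`, which need not be a root. The
    -- true roots `±i √(αβ) r` have modulus at most `α * r`, so `posLog` vanishes either way.
    by_cases hz : z = 0
    · have hs : (Real.sqrt (α * β) : ℂ) ^ 2 = α * β := by
        rw [← Complex.ofReal_pow, Real.sq_sqrt (by positivity)]; push_cast; rfl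
      have hn : Real.sqrt (α * β) ≤ α := by
        rw [Real.sqrt_le_left hα.le]; nlinarith
      have hnorm : ‖Complex.I * Real.sqrt (α * β) * r‖ ≤ α * r := by
        rw [norm_mul, norm_mul, Complex.norm_I, one_mul, Complex.norm_real, Complex.norm_real,
          Real.norm_of_nonneg (Real.sqrt_nonneg _), Real.norm_of_nonneg hr.le]
        gcongr
      refine ⟨Complex.I * Real.sqrt (α * β) * r, -(Complex.I * Real.sqrt (α * β) * r), ?_, ?_, ?_, ?_⟩
      · rw [hz]; ring
      · rw [show Complex.I * Real.sqrt (α * β) * r * -(Complex.I * Real.sqrt (α * β) * r) =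
          -(Complex.I ^ 2 * (Real.sqrt (α * β) : ℂ) ^ 2 * r ^ 2) by ring, hs, Complex.I_sq]; ring
      · rwa [norm_neg]
      · rw [ellipseGreen, hz, joukowskiRoot_zero, norm_zero, zero_div, Real.posLog_zero,
          Real.posLog_eq_zero_iff, abs_of_nonneg (by positivity), norm_div, Complex.norm_real,
          Real.norm_of_nonneg hα.le, div_div, div_le_one (by positivity)]
        exact hnorm
    · refine ⟨joukowskiRoot α β z r, z - joukowskiRoot α β z r, by ring, joukowskiRoot_mul_sub hz,
        ?_, ?_⟩
      · have h1 := norm_joukowskiRoot_mul (r := r) hα hβ hz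
        have h2 := norm_sub_joukowskiRoot_le (α := α) (β := β) (z := z) (r := r)
        refine (sq_le_sq₀ (norm_nonneg _) (by positivity)).1 ?_
        have : β * (α * r ^ 2) ≤ α * (α * r ^ 2) := by gcongr
        nlinarith [norm_nonneg (z - joukowskiRoot α β z r)]
      · rw [ellipseGreen, norm_div, Complex.norm_real, Real.norm_of_nonneg hα.le, div_div]
  have hf : ∀ w : ℂ, ‖w‖ = r → Real.log ‖z - (α * w + β * (starRingEnd ℂ) w)‖ =
      Real.log (α / r * (‖w - p / α‖ * ‖w - q / α‖)) := by
    intro w hw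
    have hw0 : w ≠ 0 := norm_pos_iff.1 (hw ▸ hr)
    have hconj : w * (starRingEnd ℂ) w = r ^ 2 := by rw [Complex.mul_conj', hw]
    have e : z - (α * w + β * (starRingEnd ℂ) w) = -(α / w) * ((w - p / α) * (w - q / α)) := by
      have h2 : (starRingEnd ℂ) w = r ^ 2 / w := by rw [eq_div_iff hw0, ← hconj]; ring
      rw [h2]
      field_simp
      rw [← hpq]
      linear_combination hmul
    rw [e, norm_mul, norm_mul, norm_neg, norm_div, Complex.norm_real, Real.norm_of_nonneg hα.le, hw]
  have h2 := circleAverage_log_mul_sub_mul_sub hr (div_pos hα hr) hf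
  have hq0 : Real.posLog (‖q / α‖ / r) = 0 := by
    rw [Real.posLog_eq_zero_iff, abs_of_nonneg (by positivity), norm_div, Complex.norm_real,
          Real.norm_of_nonneg hα.le, div_div, div_le_one (by positivity)]
    exact hq
  rw [h2, hq0, hp, Real.log_div hα.ne' hr.ne']
  ring

end Average

/-! ### Integrating the Green function over the parameter -/

section Primitive

variable {α β : ℝ} {z : ℂ} {r : ℝ}

lemma hasDerivAt_discrSqrt {u : ℂ} (hu : 1 - 4 * α * β / z ^ 2 * u ∈ Complex.slitPlane) :
    HasDerivAt (discrSqrt α β z) (-(4 * α * β / z ^ 2) / (2 * discrSqrt α β z u)) u := by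
  have h1 : HasDerivAt (fun u : ℂ => 1 - 4 * α * β / z ^ 2 * u) (-(4 * α * β / z ^ 2)) u := by
    simpa using ((hasDerivAt_id u).const_mul (4 * α * β / z ^ 2 : ℂ)).const_sub 1
  have h2 := h1.cpow_const (c := 2⁻¹) hu
  convert! h2 using 1
  rw [show (2⁻¹ - 1 : ℂ) = -2⁻¹ by norm_num, Complex.cpow_neg, ← discrSqrt]
  field_simp

/-- A primitive used to integrate `ellipseGreen`, in the variable `u = r²`. -/
def greenPrimitive (α β : ℝ) (z u : ℂ) : ℂ :=
  u * (Complex.log (1 + discrSqrt α β z u) + (1 + discrSqrt α β z u)⁻¹)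

lemma hasDerivAt_greenPrimitive {u : ℂ} (hu : 1 - 4 * α * β / z ^ 2 * u ∈ Complex.slitPlane) :
    HasDerivAt (greenPrimitive α β z) (Complex.log (1 + discrSqrt α β z u) + 1 / 2) u := by
  have hq := hasDerivAt_discrSqrt hu
  have h1q := one_add_discrSqrt_ne_zero (α := α) (β := β) (z := z) u
  have hq0 : discrSqrt α β z u ≠ 0 := by
    intro h0
    have := discrSqrt_sq (α := α) (β := β) (z := z) u
    rw [h0] at this
    exact Complex.slitPlane_ne_zero hu (by rw [← this]; ring)
  have h1 := hq.const_add 1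
  have h2 := h1.clog (one_add_discrSqrt_mem_slitPlane u)
  have h3 := h1.fun_inv h1q
  have h4 := (hasDerivAt_id u).fun_mul (h2.fun_add h3)
  refine h4.congr_deriv ?_
  have hsq := discrSqrt_sq (α := α) (β := β) (z := z) u
  simp only [id]
  generalize 4 * (α : ℂ) * β / z ^ 2 = k at *
  generalize discrSqrt α β z u = q at *
  -- This relation eliminates `u`, and the derivative of the second factor collapses to an
  -- expression in `q` alone.
  have hk : k * u = (1 - q) * (1 + q) := by linear_combination hsq
  have e : u * (-k / (2 * q) / (1 + q) + -(-k / (2 * q)) / (1 + q) ^ 2) =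
      -(k * u) / (2 * (1 + q) ^ 2) := by
    field_simp; ring
  rw [e, hk]
  field_simp
  ring

/-- The potential whose unconstrained minimizer is the ellipse with semi-axes `α + β`, `α - β`. -/
def ellipsePotential (α β : ℝ) (z : ℂ) : ℝ :=
  (‖z‖ ^ 2 - β / α * (z ^ 2).re) / (α ^ 2 - β ^ 2)

lemma ellipseLevel_nonneg (α β : ℝ) (z : ℂ) : 0 ≤ ellipseLevel α β z := by
  unfold ellipseLevel; positivity

lemma ellipseLevel_pos (hβ : 0 ≤ β) (hαβ : β < α) (hz : z ≠ 0) : 0 < ellipseLevel α β z := by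
  have h1 : 0 < α + β := by linarith
  have h2 : 0 < α - β := by linarith
  refine (ellipseLevel_nonneg α β z).lt_of_ne' fun h => hz ?_
  rw [ellipseLevel, add_eq_zero_iff_of_nonneg (by positivity) (by positivity)] at h
  apply Complex.ext
  · simpa [h1.ne'] using h.1
  · simpa [h2.ne'] using h.2

/-- A primitive of `2 r * ellipseGreen α β z r` in the region where the latter is positive. -/
def ellipseGreenPrimitive (α β : ℝ) (z : ℂ) (r : ℝ) : ℝ :=
  (greenPrimitive α β z (r ^ 2 : ℝ)).re + r ^ 2 * Real.log (‖z‖ / (2 * α)) - r * (r * Real.log r)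

lemma log_norm_joukowskiRoot_div (hα : 0 < α) (hz : z ≠ 0) (hr : 0 < r) :
    Real.log (‖joukowskiRoot α β z r‖ / (α * r)) =
      (Complex.log (1 + discrSqrt α β z (r ^ 2 : ℝ))).re + Real.log (‖z‖ / (2 * α)) - Real.log r := by
  have h1 : ‖1 + discrSqrt α β z (r ^ 2 : ℝ)‖ ≠ 0 :=
    norm_ne_zero_iff.2 (one_add_discrSqrt_ne_zero _)
  have h2 : ‖z‖ ≠ 0 := norm_ne_zero_iff.2 hz
  rw [Complex.log_re, joukowskiRoot, norm_div, norm_mul, Complex.norm_two, ← Real.log_mul h1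
    (by positivity), ← Real.log_div (by positivity) hr.ne']
  congr 1
  field_simp

variable (hβ : 0 ≤ β) (hαβ : β < α)
include hβ hαβ

lemma hasDerivAt_re_greenPrimitive_sq (hz : z ≠ 0) (h : r ^ 2 ≤ ellipseLevel α β z) :
    HasDerivAt (fun r : ℝ => (greenPrimitive α β z (r ^ 2 : ℝ)).re)
      ((Complex.log (1 + discrSqrt α β z (r ^ 2 : ℝ)) + 1 / 2).re * (2 * r)) r := by
  have h1 := (hasDerivAt_greenPrimitive (slitPlane_of_sq_le_level hβ hαβ hz h)).real_of_complex
  have h2 : HasDerivAt (fun r : ℝ => r ^ 2) (2 * r) r := by simpa using hasDerivAt_pow 2 r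
  exact HasDerivAt.comp (h₂ := fun u : ℝ => (greenPrimitive α β z u).re) (h := fun r => r ^ 2) r h1 h2

/-- The summand `1/2` in the derivative of `greenPrimitive` contributes `r`, which cancels the extra
`r` from differentiating `r² log r`. -/
lemma hasDerivAt_ellipseGreenPrimitive (hz : z ≠ 0) (hr : 0 < r) (h : r ^ 2 ≤ ellipseLevel α β z) :
    HasDerivAt (ellipseGreenPrimitive α β z) (2 * r * ellipseGreen α β z r) r := by
  have hα : 0 < α := by linarith
  have h1 := hasDerivAt_re_greenPrimitive_sq hβ hαβ hz h
  have h2 : HasDerivAt (fun r : ℝ => r ^ 2) (2 * r) r := by simpa using hasDerivAt_pow 2 r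
  have h3 := (hasDerivAt_id r).fun_mul (Real.hasDerivAt_mul_log hr.ne')
  refine ((h1.fun_add (h2.mul_const (Real.log (‖z‖ / (2 * α))))).fun_sub h3).congr_deriv ?_
  rw [ellipseGreen_eq_log hβ hαβ hz hr h, log_norm_joukowskiRoot_div hα hz hr, Complex.add_re]
  norm_num
  ring

lemma continuousOn_ellipseGreenPrimitive (hz : z ≠ 0) :
    ContinuousOn (ellipseGreenPrimitive α β z) (Set.Icc 0 (Real.sqrt (ellipseLevel α β z))) := by
  intro r hr
  have h : r ^ 2 ≤ ellipseLevel α β z := by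
    have h0 := ellipseLevel_nonneg α β z
    have := pow_le_pow_left₀ hr.1 hr.2 2
    rwa [Real.sq_sqrt h0] at this
  have h1 := (hasDerivAt_re_greenPrimitive_sq hβ hαβ hz h).continuousAt
  have h2 : Continuous fun r : ℝ => r ^ 2 * Real.log (‖z‖ / (2 * α)) := by fun_prop
  have h3 : Continuous fun r : ℝ => r * (r * Real.log r) := continuous_id.mul Real.continuous_mul_log
  exact ((h1.add h2.continuousAt).sub h3.continuousAt).continuousWithinAt

omit hβ hαβ in
lemma ellipseGreen_nonneg (z : ℂ) (r : ℝ) : 0 ≤ ellipseGreen α β z r := Real.posLog_nonneg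

omit hβ hαβ in
lemma ellipseGreenPrimitive_zero : ellipseGreenPrimitive α β z 0 = 0 := by
  simp [ellipseGreenPrimitive, greenPrimitive]

/-- On the ellipse `|h| = αr`, so the logarithms cancel and `r² Re (z / (2h))` remains. Inserting `z
= h + (β/α) conj h` makes this a quadratic form in `z`. -/
lemma ellipseGreenPrimitive_of_level (hz : z ≠ 0) (hr : 0 < r) (h : r ^ 2 = ellipseLevel α β z) :
    ellipseGreenPrimitive α β z r = ellipsePotential α β z / 2 := by
  have hα : 0 < α := by linarith
  have hn : ‖joukowskiRoot α β z r‖ = α * r :=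
    le_antisymm (norm_joukowskiRoot_le hβ hαβ hz hr h.ge) (le_norm_joukowskiRoot hβ hαβ hz hr h.le)
  have h1 := log_norm_joukowskiRoot_div (β := β) hα hz hr
  rw [hn, div_self (by positivity), Real.log_one] at h1
  have h2 : ellipseGreenPrimitive α β z r =
      r ^ 2 * ((1 + discrSqrt α β z (r ^ 2 : ℝ))⁻¹).re := by
    rw [ellipseGreenPrimitive, greenPrimitive, Complex.re_ofReal_mul, Complex.add_re]
    linear_combination -r ^ 2 * h1
  have h3 : (1 + discrSqrt α β z (r ^ 2 : ℝ))⁻¹ = z / (2 * joukowskiRoot α β z r) := by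
    have := one_add_discrSqrt_ne_zero (α := α) (β := β) (z := z) (r ^ 2 : ℝ)
    rw [joukowskiRoot]; field_simp
  have hh := joukowskiRoot_ne_zero (α := α) (β := β) (r := r) hz
  have hmul := joukowskiRoot_mul_sub (α := α) (β := β) (r := r) hz
  rw [h2, h3]
  generalize joukowskiRoot α β z r = w at *
  have hαc : (α : ℂ) ≠ 0 := by exact_mod_cast hα.ne'
  have hrc : (r : ℂ) ≠ 0 := by exact_mod_cast hr.ne'
  have hconj : w * (starRingEnd ℂ) w = α ^ 2 * r ^ 2 := by
    rw [Complex.mul_conj', hn]; push_cast; ring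
  have hzw : z = w + (β / α : ℝ) * (starRingEnd ℂ) w := by
    apply mul_left_cancel₀ hh
    push_cast
    rw [mul_add, mul_left_comm, hconj]
    field_simp
    linear_combination hmul
  have hzd : z / (2 * w) = ((2 * α ^ 2 * r ^ 2 : ℝ) : ℂ)⁻¹ * (z * (starRingEnd ℂ) w) := by
    push_cast
    rw [mul_assoc (2 : ℂ), ← hconj]
    have : (starRingEnd ℂ) w ≠ 0 := by simpa using hh
    field_simp
  have hw : w.re ^ 2 + w.im ^ 2 = α ^ 2 * r ^ 2 := by
    have : ‖w‖ ^ 2 = (α * r) ^ 2 := by rw [hn]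
    rw [Complex.sq_norm, Complex.normSq_apply] at this
    linarith
  have hre : z.re = w.re * (1 + β / α) := by
    conv_lhs => rw [hzw]
    simp only [Complex.add_re, Complex.re_ofReal_mul, Complex.conj_re]; ring
  have him : z.im = w.im * (1 - β / α) := by
    conv_lhs => rw [hzw]
    simp only [Complex.add_im, Complex.im_ofReal_mul, Complex.conj_im]; ring
  rw [hzd, ← Complex.ofReal_inv, Complex.re_ofReal_mul, ellipsePotential, Complex.sq_norm,
    Complex.normSq_apply, Complex.mul_re, Complex.conj_re, Complex.conj_im, sq z, Complex.mul_re,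
    hre, him]
  have hd : α ^ 2 - β ^ 2 ≠ 0 := by nlinarith
  field_simp
  ring

lemma integral_ellipseGreen_sqrt_level (hz : z ≠ 0) :
    IntervalIntegrable (fun r => 2 * r * ellipseGreen α β z r) volume 0
      (Real.sqrt (ellipseLevel α β z)) ∧
    ∫ r in (0 : ℝ)..Real.sqrt (ellipseLevel α β z), 2 * r * ellipseGreen α β z r =
      ellipsePotential α β z / 2 := by
  have hlev := ellipseLevel_pos hβ hαβ hz
  have hρ : 0 < Real.sqrt (ellipseLevel α β z) := Real.sqrt_pos.2 hlev
  have hder : ∀ r ∈ Set.Ioo 0 (Real.sqrt (ellipseLevel α β z)),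
      HasDerivAt (ellipseGreenPrimitive α β z) (2 * r * ellipseGreen α β z r) r := by
    intro r hr
    refine hasDerivAt_ellipseGreenPrimitive hβ hαβ hz hr.1 ?_
    have := pow_le_pow_left₀ hr.1.le hr.2.le 2
    rwa [Real.sq_sqrt hlev.le] at this
  have hcont := continuousOn_ellipseGreenPrimitive hβ hαβ hz
  have hint : IntervalIntegrable (fun r => 2 * r * ellipseGreen α β z r) volume 0
      (Real.sqrt (ellipseLevel α β z)) := by
    -- The derivative of a continuous function is integrable once it is nonnegative, so no estimate
    -- near `r = 0` is needed.
    refine intervalIntegral.intervalIntegrable_deriv_of_nonneg (g := ellipseGreenPrimitive α β z)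
      ?_ ?_ ?_
    · rwa [Set.uIcc_of_le hρ.le]
    · rwa [min_eq_left hρ.le, max_eq_right hρ.le]
    · rw [min_eq_left hρ.le, max_eq_right hρ.le]
      intro r hr
      exact mul_nonneg (by linarith [hr.1]) (ellipseGreen_nonneg z r)
  refine ⟨hint, ?_⟩
  rw [intervalIntegral.integral_eq_sub_of_hasDerivAt_of_le hρ.le hcont hder hint,
    ellipseGreenPrimitive_zero, sub_zero,
    ellipseGreenPrimitive_of_level hβ hαβ hz hρ (Real.sq_sqrt hlev.le)]

lemma integral_ellipseGreen_of_level_le {T : ℝ} (hT : 0 ≤ T) (hlev : ellipseLevel α β z ≤ T ^ 2) :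
    IntervalIntegrable (fun r => 2 * r * ellipseGreen α β z r) volume 0 T ∧
    ∫ r in (0 : ℝ)..T, 2 * r * ellipseGreen α β z r = ellipsePotential α β z / 2 := by
  have hzero : ∀ c, 0 ≤ c → c ≤ T → ellipseLevel α β z ≤ c ^ 2 →
      IntervalIntegrable (fun r => 2 * r * ellipseGreen α β z r) volume c T ∧
      ∫ r in c..T, 2 * r * ellipseGreen α β z r = 0 := by
    intro c hc hcT hlc
    have he : Set.EqOn (fun r => 2 * r * ellipseGreen α β z r) (fun _ => 0) (Set.uIoc c T) := by
      intro r hr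
      rw [Set.uIoc_of_le hcT] at hr
      have := ellipseGreen_eq_zero hβ hαβ (z := z) (r := r) (by linarith [hr.1])
        (hlc.trans (pow_le_pow_left₀ hc hr.1.le 2))
      simp [this]
    refine ⟨(intervalIntegrable_congr he).2 (by simp), ?_⟩
    exact intervalIntegral.integral_zero_ae (ae_of_all _ he)
  by_cases hz : z = 0
  · have := hzero 0 le_rfl hT (by simp [hz, ellipseLevel])
    refine ⟨this.1, this.2.trans ?_⟩
    simp [hz, ellipsePotential]
  · obtain ⟨h1, h2⟩ := integral_ellipseGreen_sqrt_level hβ hαβ hz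
    obtain ⟨h3, h4⟩ := hzero (Real.sqrt (ellipseLevel α β z)) (Real.sqrt_nonneg _)
      (by rw [Real.sqrt_le_left hT]; exact hlev)
      (by rw [Real.sq_sqrt (ellipseLevel_nonneg α β z)])
    refine ⟨h1.trans h3, ?_⟩
    rw [← intervalIntegral.integral_add_adjacent_intervals h1 h3, h2, h4, add_zero]

lemma integral_ellipseGreen_le {T : ℝ} (hT : 0 ≤ T) (z : ℂ) :
    IntervalIntegrable (fun r => 2 * r * ellipseGreen α β z r) volume 0 T ∧
    ∫ r in (0 : ℝ)..T, 2 * r * ellipseGreen α β z r ≤ ellipsePotential α β z / 2 := by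
  -- Up to `M` the full integral `V/2` is reached; stopping at `T` drops a nonnegative part.
  set M := max T (Real.sqrt (ellipseLevel α β z)) with hM
  have hTM : T ≤ M := le_max_left _ _
  have hM0 : 0 ≤ M := hT.trans hTM
  obtain ⟨h1, h2⟩ := integral_ellipseGreen_of_level_le hβ hαβ (z := z) hM0
    ((Real.sqrt_le_left hM0).1 (le_max_right _ _))
  refine ⟨h1.mono_set ?_, ?_⟩
  · rw [Set.uIcc_of_le hT, Set.uIcc_of_le hM0]
    exact Set.Icc_subset_Icc_right hTM
  · rw [← h2]
    refine intervalIntegral.integral_mono_interval le_rfl hT hTM ?_ h1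
    filter_upwards [ae_restrict_mem measurableSet_Ioc] with r hr
    exact mul_nonneg (by linarith [hr.1]) (ellipseGreen_nonneg z r)

end Primitive

/-! ### Area integrals and integrability of the kernel -/

/-- Polar coordinates on the unit disk, in terms of circle averages. -/
lemma setIntegral_ball_eq_integral_circleAverage {f : ℂ → ℝ} (hf : Measurable f)
    (hi : IntegrableOn f (Metric.ball 0 1)) :
    ∫ w in Metric.ball (0 : ℂ) 1, f w =
      ∫ r in (0 : ℝ)..1, 2 * Real.pi * r * Real.circleAverage f 0 r := by
  set F : ℂ → ℝ := (Metric.ball (0 : ℂ) 1).indicator f with hF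
  have hFm : Measurable F := hf.indicator Metric.isOpen_ball.measurableSet
  have hFi : Integrable F := (integrable_indicator_iff Metric.isOpen_ball.measurableSet).2 hi
  have hpolm : Measurable (fun p : ℝ × ℝ => Complex.polarCoord.symm p) := by
    simp only [Complex.polarCoord_symm_apply]; fun_prop
  have hint : IntegrableOn (fun p : ℝ × ℝ => p.1 • F (Complex.polarCoord.symm p))
      (Set.Ioi 0 ×ˢ Set.Ioo (-Real.pi) Real.pi) := by
    refine ⟨(measurable_fst.smul (hFm.comp hpolm)).aestronglyMeasurable, ?_⟩
    rw [hasFiniteIntegral_iff_enorm]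
    have h1 := Complex.lintegral_comp_polarCoord_symm (fun z => ‖F z‖ₑ)
    have h2 : ∫⁻ z, ‖F z‖ₑ < ⊤ := hFi.2
    rw [← h1, polarCoord_target] at h2
    refine lt_of_le_of_lt (le_of_eq ?_) h2
    refine setLIntegral_congr_fun (measurableSet_Ioi.prod measurableSet_Ioo) fun p hp => ?_
    rw [enorm_smul, Real.enorm_of_nonneg (le_of_lt hp.1), smul_eq_mul]
  rw [← integral_indicator Metric.isOpen_ball.measurableSet, ← hF,
    ← Complex.integral_comp_polarCoord_symm, polarCoord_target, Measure.volume_eq_prod,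
    setIntegral_prod _ hint, intervalIntegral.integral_of_le zero_le_one]
  have hsub : Set.Ioo (0 : ℝ) 1 ⊆ Set.Ioi 0 := fun r hr => hr.1
  rw [integral_Ioc_eq_integral_Ioo]
  rw [setIntegral_eq_of_subset_of_forall_sdiff_eq_zero measurableSet_Ioi hsub]
  · refine setIntegral_congr_fun measurableSet_Ioo fun r hr => ?_
    have hpt : ∀ θ : ℝ, F (Complex.polarCoord.symm (r, θ)) = f (circleMap 0 r θ) := by
      intro θ
      have e : Complex.polarCoord.symm (r, θ) = circleMap 0 r θ := by
        rw [Complex.polarCoord_symm_apply, circleMap, zero_add, Complex.exp_mul_I]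
        push_cast; rfl
      rw [e, hF, Set.indicator_of_mem]
      simpa [abs_of_pos hr.1] using hr.2
    simp only [hpt, smul_eq_mul]
    rw [integral_const_mul, ← integral_Ioc_eq_integral_Ioo,
      ← intervalIntegral.integral_of_le (by linarith [Real.pi_pos]),
      Real.circleAverage_eq_integral_add (-Real.pi),
      intervalIntegral.integral_comp_add_right (fun θ => f (circleMap 0 r θ)), smul_eq_mul]
    have hpi := Real.pi_ne_zero
    rw [zero_add, show 2 * Real.pi + -Real.pi = Real.pi by ring]
    field_simp
  · intro r hr
    have h1 : (1 : ℝ) ≤ r := by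
      by_contra h
      exact hr.2 ⟨hr.1, not_le.1 h⟩
    have hpt : ∀ θ : ℝ, F (Complex.polarCoord.symm (r, θ)) = 0 := by
      intro θ
      rw [hF, Set.indicator_of_notMem]
      rw [mem_ball_zero_iff, Complex.norm_polarCoord_symm, not_lt]
      exact h1.trans (le_abs_self r)
    simp only [hpt, smul_zero, integral_zero]

section Kernel

/-- The singular part of the logarithmic kernel. -/
def logSingular : ℂ → ℝ := fun w => (Set.Iio (1 : ℝ)).indicator (fun y => |Real.log y|) ‖w‖

lemma integrable_logSingular : Integrable logSingular := by
  have h := integrable_fun_norm_addHaar (E := ℂ) (F := ℝ) volume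
    (f := (Set.Iio (1 : ℝ)).indicator (fun y => |Real.log y|))
  refine h.2 ?_
  rw [Complex.finrank_real_complex]
  have hb : Integrable ((Set.Ioo (0 : ℝ) 1).indicator (fun _ => (1 : ℝ))) :=
    (integrable_indicator_iff measurableSet_Ioo).2 (integrableOn_const (by simp))
  refine Integrable.mono hb.integrableOn ?_ ?_
  · refine Measurable.aestronglyMeasurable ?_
    exact (measurable_id.pow_const _).smul
      ((Real.measurable_log.abs).indicator measurableSet_Iio)
  · filter_upwards [ae_restrict_mem measurableSet_Ioi] with y (hy : 0 < y)
    by_cases h1 : y < 1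
    · rw [Set.indicator_of_mem (by exact h1), Set.indicator_of_mem (by exact ⟨hy, h1⟩),
        smul_eq_mul, norm_mul, norm_one, Real.norm_eq_abs, Real.norm_eq_abs, abs_abs,
        abs_of_pos (by positivity), show 2 - 1 = 1 from rfl, pow_one, mul_comm, ← abs_of_pos hy,
        ← abs_mul]
      rw [abs_of_pos hy]
      exact (Real.abs_log_mul_self_lt y hy h1.le).le
    · rw [Set.indicator_of_notMem (by exact h1)]
      simp

lemma abs_logKernel_le (z ζ : ℂ) : |logKernel z ζ| ≤ ‖z‖ + ‖ζ‖ + logSingular (z - ζ) := by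
  rw [logKernel_eq, abs_neg, logSingular]
  by_cases h : ‖z - ζ‖ < 1
  · rw [Set.indicator_of_mem (by exact h)]
    have := norm_nonneg z
    have := norm_nonneg ζ
    linarith
  · rw [Set.indicator_of_notMem (by exact h), add_zero]
    rw [not_lt] at h
    rw [abs_of_nonneg (Real.log_nonneg h)]
    exact ((Real.log_le_sub_one_of_pos (by linarith)).trans (by linarith)).trans (norm_sub_le z ζ)

/-- A first moment of `ν` controls the kernel at infinity. By translation invariance the singular
part has the same Lebesgue integral in `ζ` for every `z`, so no regularity of `ν` is needed. -/
lemma integrable_logKernel_prod {ν : Measure ℂ} [IsFiniteMeasure ν]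
    (hν : Integrable (fun z => ‖z‖) ν) {D : Set ℂ} (hDb : Bornology.IsBounded D)
    (hDm : MeasurableSet D) {c : ENNReal} (hc : c ≠ ⊤) :
    Integrable (fun p : ℂ × ℂ => logKernel p.1 p.2) (ν.prod (c • volume.restrict D)) := by
  have : IsFiniteMeasure (volume.restrict D) := ⟨by simpa using hDb.measure_lt_top⟩
  obtain ⟨R, hR⟩ := hDb.exists_norm_le
  have hsing : Integrable (fun p : ℂ × ℂ => logSingular (p.1 - p.2)) (ν.prod volume) := by
    have hm : Measurable logSingular :=
      ((Real.measurable_log.abs).indicator measurableSet_Iio).comp measurable_norm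
    have hms : Measurable fun p : ℂ × ℂ => logSingular (p.1 - p.2) :=
      hm.comp (measurable_fst.sub measurable_snd)
    rw [integrable_prod_iff hms.aestronglyMeasurable]
    constructor
    · exact ae_of_all _ fun z => integrable_logSingular.comp_sub_left z
    · simp only [integral_sub_left_eq_self (fun w => ‖logSingular w‖) volume]
      exact integrable_const _
  have hprod : ν.prod (volume.restrict D) = (ν.prod volume).restrict (Set.univ ×ˢ D) := by
    rw [← Measure.prod_restrict, Measure.restrict_univ]
  rw [Measure.prod_smul_right]
  refine Integrable.smul_measure ?_ hc
  have h1 : Integrable (fun p : ℂ × ℂ => ‖p.1‖) (ν.prod (volume.restrict D)) := hν.comp_fst _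
  have h2 : Integrable (fun p : ℂ × ℂ => ‖p.2‖) (ν.prod (volume.restrict D)) := by
    refine Integrable.comp_snd (f := fun z : ℂ => ‖z‖) ?_ ν
    refine (integrable_const R).mono (by fun_prop) ?_
    filter_upwards [ae_restrict_mem hDm] with z hz
    rw [norm_norm]
    exact (hR z hz).trans (le_abs_self R)
  have h3 : Integrable (fun p : ℂ × ℂ => logSingular (p.1 - p.2)) (ν.prod (volume.restrict D)) := by
    rw [hprod]; exact hsing.restrict
  refine ((h1.add h2).add h3).mono measurable_logKernel.aestronglyMeasurable (ae_of_all _ fun p => ?_)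
  exact (abs_logKernel_le p.1 p.2).trans (le_abs_self _)

lemma integrable_logKernel {D : Set ℂ} (hDb : Bornology.IsBounded D)
    (hDm : MeasurableSet D) {c : ENNReal} (hc : c ≠ ⊤) (z : ℂ) :
    Integrable (fun ζ => logKernel z ζ) (c • volume.restrict D) := by
  -- A Dirac mass at `z` reduces the pointwise statement to the one on the product.
  have h := integrable_logKernel_prod (ν := Measure.dirac z) (integrable_dirac (by simp)) hDb hDm hc
  rw [Measure.dirac_prod, integrable_map_measure measurable_logKernel.aestronglyMeasurable
    (by fun_prop)] at h
  exact h

end Kernel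

/-! ### The uniform measure on an ellipse and its potential -/

section EllipseMeasure

/-- The normalized area measure on the ellipse with semi-axes `a`, `b`. -/
def ellipseMeasure (s : ℂ) (a b : ℝ) : Measure ℂ :=
  ENNReal.ofReal (1 / (Real.pi * a * b)) • (volume : Measure ℂ).restrict (ellipseInterior s a b)

/-- The real linear map that takes the unit disk to an ellipse. -/
def ellipseMap (s : ℂ) (α β : ℝ) : ℂ →ₗ[ℝ] ℂ :=
  (LinearMap.mulLeft ℝ ((starRingEnd ℂ) s)).comp
    (α • LinearMap.id + β • Complex.conjAe.toLinearMap)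

variable {s : ℂ} {α β : ℝ}

lemma ellipseMap_apply (w : ℂ) :
    ellipseMap s α β w = (starRingEnd ℂ) s * (α * w + β * (starRingEnd ℂ) w) := by
  simp [ellipseMap]

lemma det_ellipseMap (hs : ‖s‖ = 1) : LinearMap.det (ellipseMap s α β) = (α + β) * (α - β) := by
  rw [← LinearMap.det_toMatrix Complex.basisOneI, Matrix.det_fin_two]
  have h1 : s.re * s.re + s.im * s.im = 1 := by
    rw [← Complex.normSq_apply, ← Complex.sq_norm, hs, one_pow]
  simp only [LinearMap.toMatrix_apply, Complex.coe_basisOneI, Complex.coe_basisOneI_repr,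
    ellipseMap_apply]
  simp
  linear_combination (α + β) * (α - β) * h1

lemma mul_ellipseMap (hs : ‖s‖ = 1) (w : ℂ) :
    s * ellipseMap s α β w = α * w + β * (starRingEnd ℂ) w := by
  rw [ellipseMap_apply, ← mul_assoc, Complex.mul_conj', hs]
  simp

lemma ellipseMap_preimage (hs : ‖s‖ = 1) (hβ : 0 ≤ β) (hαβ : β < α) :
    ellipseMap s α β ⁻¹' ellipseInterior s (α + β) (α - β) = Metric.ball 0 1 := by
  ext w
  have h1 : α + β ≠ 0 := by linarith
  have h2 : α - β ≠ 0 := by linarith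
  have hre : (s * ellipseMap s α β w).re = (α + β) * w.re := by
    rw [mul_ellipseMap hs, Complex.add_re, Complex.re_ofReal_mul, Complex.re_ofReal_mul,
      Complex.conj_re]; ring
  have him : (s * ellipseMap s α β w).im = (α - β) * w.im := by
    rw [mul_ellipseMap hs, Complex.add_im, Complex.im_ofReal_mul, Complex.im_ofReal_mul,
      Complex.conj_im]; ring
  rw [Set.mem_preimage, ellipseInterior, Set.mem_ofPred_eq, mem_ball_zero_iff, hre, him, mul_pow,
    mul_pow, mul_div_cancel_left₀ _ (pow_ne_zero 2 h1), mul_div_cancel_left₀ _ (pow_ne_zero 2 h2),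
    ← sq_lt_one_iff₀ (norm_nonneg w), Complex.sq_norm, Complex.normSq_apply, sq, sq]

lemma isOpen_ellipseInterior (s : ℂ) (a b : ℝ) : IsOpen (ellipseInterior s a b) :=
  isOpen_lt (by fun_prop) continuous_const

lemma ellipseMeasure_eq_map (hs : ‖s‖ = 1) (hβ : 0 ≤ β) (hαβ : β < α) :
    ellipseMeasure s (α + β) (α - β) =
      (ENNReal.ofReal (1 / Real.pi) • (volume : Measure ℂ).restrict (Metric.ball 0 1)).map
        (ellipseMap s α β) := by
  have h1 : 0 < α + β := by linarith
  have h2 : 0 < α - β := by linarith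
  have hm : Measurable (ellipseMap s α β) :=
    (LinearMap.continuous_of_finiteDimensional _).measurable
  have hdet := det_ellipseMap (α := α) (β := β) hs
  have hmap := Measure.map_linearMap_addHaar_eq_smul_addHaar (volume : Measure ℂ)
    (f := ellipseMap s α β) (by rw [hdet]; positivity)
  rw [Measure.map_smul, ← ellipseMap_preimage hs hβ hαβ,
    ← Measure.restrict_map hm (isOpen_ellipseInterior _ _ _).measurableSet, hmap, hdet,
    Measure.restrict_smul, smul_smul, ellipseMeasure, ← ENNReal.ofReal_mul (by positivity),
    abs_of_pos (by positivity)]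
  congr 2
  field_simp

lemma isProbabilityMeasure_ellipseMeasure (hs : ‖s‖ = 1) (hβ : 0 ≤ β) (hαβ : β < α) :
    IsProbabilityMeasure (ellipseMeasure s (α + β) (α - β)) := by
  have hm : Measurable (ellipseMap s α β) :=
    (LinearMap.continuous_of_finiteDimensional _).measurable
  constructor
  rw [ellipseMeasure_eq_map hs hβ hαβ, Measure.map_apply hm MeasurableSet.univ, Set.preimage_univ,
    Measure.smul_apply, Measure.restrict_apply_univ, Complex.volume_ball, ENNReal.ofReal_one,
    one_pow, one_mul, smul_eq_mul, ← ENNReal.ofReal_coe_nnreal, ← ENNReal.ofReal_mul (by positivity),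
    NNReal.coe_real_pi, one_div_mul_cancel Real.pi_ne_zero, ENNReal.ofReal_one]

lemma ellipseMeasure_singleton (s : ℂ) (a b : ℝ) (z : ℂ) : ellipseMeasure s a b {z} = 0 := by
  simp [ellipseMeasure]

lemma isBounded_ellipseInterior (hs : ‖s‖ = 1) {a b : ℝ} (ha : 0 < a) (hb : 0 < b) :
    Bornology.IsBounded (ellipseInterior s a b) := by
  refine (Metric.isBounded_iff_subset_closedBall 0).2 ⟨a + b, fun z hz => ?_⟩
  rw [mem_closedBall_zero_iff]
  have h1 : ‖z‖ = ‖s * z‖ := by rw [norm_mul, hs, one_mul]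
  rw [ellipseInterior, Set.mem_ofPred_eq] at hz
  have hx : 0 ≤ (s * z).re ^ 2 / a ^ 2 := by positivity
  have hy : 0 ≤ (s * z).im ^ 2 / b ^ 2 := by positivity
  have hx1 : (s * z).re ^ 2 < 1 * a ^ 2 := by rw [← div_lt_iff₀ (by positivity)]; linarith
  have hy1 : (s * z).im ^ 2 < 1 * b ^ 2 := by rw [← div_lt_iff₀ (by positivity)]; linarith
  rw [h1]
  refine (Complex.norm_le_abs_re_add_abs_im _).trans (add_le_add ?_ ?_)
  · exact abs_le_of_sq_le_sq (by linarith) ha.le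
  · exact abs_le_of_sq_le_sq (by linarith) hb.le

/-- The logarithmic potential of the ellipse in terms of Green functions. -/
lemma integral_logKernel_ellipseMeasure (hs : ‖s‖ = 1) (hβ : 0 ≤ β) (hαβ : β < α) (z : ℂ) :
    ∫ ζ, logKernel z ζ ∂(ellipseMeasure s (α + β) (α - β)) =
      -(∫ r in (0 : ℝ)..1, 2 * r * (Real.log α + Real.log r)) -
        ∫ r in (0 : ℝ)..1, 2 * r * ellipseGreen α β (s * z) r := by
  have h1 : 0 < α + β := by linarith
  have h2 : 0 < α - β := by linarith
  have hm : Measurable (ellipseMap s α β) :=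
    (LinearMap.continuous_of_finiteDimensional _).measurable
  have hint := integrable_logKernel (isBounded_ellipseInterior hs h1 h2)
    (isOpen_ellipseInterior s (α + β) (α - β)).measurableSet
    (c := ENNReal.ofReal (1 / (Real.pi * (α + β) * (α - β)))) ENNReal.ofReal_ne_top z
  rw [← ellipseMeasure, ellipseMeasure_eq_map hs hβ hαβ] at hint
  have hkm : Measurable fun ζ => logKernel z ζ := by unfold logKernel; fun_prop
  rw [integrable_map_measure hkm.aestronglyMeasurable hm.aemeasurable,
    integrable_smul_measure (by simp [Real.pi_pos]) ENNReal.ofReal_ne_top] at hint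
  have he : ∀ w : ℂ, logKernel z (ellipseMap s α β w) =
      -Real.log ‖s * z - (α * w + β * (starRingEnd ℂ) w)‖ := by
    intro w
    rw [logKernel_eq, ← mul_ellipseMap hs, ← mul_sub, norm_mul, hs, one_mul]
  have hfm : Measurable fun w : ℂ => Real.log ‖s * z - (α * w + β * (starRingEnd ℂ) w)‖ := by
    have : Measurable (starRingEnd ℂ) := Complex.continuous_conj.measurable
    fun_prop
  have hfi : IntegrableOn (fun w : ℂ => Real.log ‖s * z - (α * w + β * (starRingEnd ℂ) w)‖)
      (Metric.ball 0 1) := by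
    refine hint.neg.congr (ae_of_all _ fun w => ?_)
    simp only [Pi.neg_apply, Function.comp_apply, he, neg_neg]
  rw [ellipseMeasure_eq_map hs hβ hαβ, integral_map hm.aemeasurable hkm.aestronglyMeasurable,
    integral_smul_measure, ENNReal.toReal_ofReal (by positivity)]
  simp_rw [he]
  rw [integral_neg, setIntegral_ball_eq_integral_circleAverage hfm hfi, smul_eq_mul, mul_neg,
    ← intervalIntegral.integral_const_mul]
  have hc : IntervalIntegrable (fun r : ℝ => 2 * r * (Real.log α + Real.log r)) volume 0 1 := by
    have : Continuous fun r : ℝ => 2 * r * Real.log α + 2 * (r * Real.log r) := by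
      have := Real.continuous_mul_log
      fun_prop
    refine (this.congr fun r => ?_).intervalIntegrable 0 1
    ring
  rw [← neg_add', ← intervalIntegral.integral_add hc
    (integral_ellipseGreen_le hβ hαβ zero_le_one (s * z)).1]
  congr 1
  refine intervalIntegral.integral_congr_Ioo_of_le zero_le_one fun r hr => ?_
  rw [circleAverage_log_norm_sub_ellipse hβ hαβ hr.1]
  have := Real.pi_ne_zero
  field_simp

/-- The constant value of `V + 2 U` on the ellipse. -/
def robinConstant (α : ℝ) : ℝ := -2 * ∫ r in (0 : ℝ)..1, 2 * r * (Real.log α + Real.log r)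

/-- The variational inequality. -/
lemma robinConstant_le (hs : ‖s‖ = 1) (hβ : 0 ≤ β) (hαβ : β < α) (z : ℂ) :
    robinConstant α ≤ ellipsePotential α β (s * z) +
      2 * ∫ ζ, logKernel z ζ ∂(ellipseMeasure s (α + β) (α - β)) := by
  rw [integral_logKernel_ellipseMeasure hs hβ hαβ, robinConstant]
  have := (integral_ellipseGreen_le hβ hαβ zero_le_one (s * z)).2
  linarith

/-- The variational equality. -/
lemma robinConstant_eq (hs : ‖s‖ = 1) (hβ : 0 ≤ β) (hαβ : β < α) {z : ℂ}
    (hz : z ∈ ellipseInterior s (α + β) (α - β)) :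
    ellipsePotential α β (s * z) +
      2 * ∫ ζ, logKernel z ζ ∂(ellipseMeasure s (α + β) (α - β)) = robinConstant α := by
  have hlev : ellipseLevel α β (s * z) ≤ 1 ^ 2 := by rw [one_pow]; exact le_of_lt hz
  rw [integral_logKernel_ellipseMeasure hs hβ hαβ, robinConstant]
  have := (integral_ellipseGreen_of_level_le hβ hαβ zero_le_one hlev).2
  linarith

end EllipseMeasure

/-! ### Variational conditions and uniqueness -/

lemma energy_of_integrable {V : ℂ → ℝ} {μ : Measure ℂ} [SFinite μ] (hV : Integrable V μ)
    (hk : Integrable (fun p : ℂ × ℂ => logKernel p.1 p.2) (μ.prod μ)) :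
    energy V μ = ((∫ z, V z ∂μ + ∫ p, logKernel p.1 p.2 ∂(μ.prod μ) : ℝ) : EReal) := by
  rw [energy, if_pos ⟨hV, hk⟩, integral_prod _ hk]

/-- A measure that satisfies the variational conditions on the support and off the support is
the unique equilibrium measure. -/
theorem isEquilibriumMeasure_iff_of_variational {V : ℂ → ℝ} {μ₀ : Measure ℂ}
    (hμ₀ : IsAdmissibleMeasure Set.univ μ₀) (hV : Integrable V μ₀)
    (hk : Integrable (fun p : ℂ × ℂ => logKernel p.1 p.2) (μ₀.prod μ₀))
    (hcross : ∀ ν, IsAdmissibleMeasure Set.univ ν → Integrable V ν →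
      Integrable (fun p : ℂ × ℂ => logKernel p.1 p.2) (ν.prod μ₀))
    {F : ℝ} (hle : ∀ z, F ≤ V z + 2 * ∫ ζ, logKernel z ζ ∂μ₀)
    (heq : ∀ᵐ z ∂μ₀, V z + 2 * ∫ ζ, logKernel z ζ ∂μ₀ = F) (μ : Measure ℂ) :
    IsEquilibriumMeasure V Set.univ μ ↔ μ = μ₀ := by
  have := hμ₀.isProbabilityMeasure
  have key : ∀ ν, IsAdmissibleMeasure Set.univ ν → energy V μ₀ ≤ energy V ν ∧
      (energy V ν ≤ energy V μ₀ → ν = μ₀) := by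
    intro ν hν
    have := hν.isProbabilityMeasure
    rw [energy_of_integrable hV hk]
    by_cases h : Integrable V ν ∧ Integrable (fun p : ℂ × ℂ => logKernel p.1 p.2) (ν.prod ν)
    · obtain ⟨h1, h2⟩ := h
      have h3 := hcross ν hν h1
      rw [energy_of_integrable h1 h2, EReal.coe_le_coe_iff, EReal.coe_le_coe_iff]
      have hU := h3.integral_prod_left
      have hU₀ := hk.integral_prod_left
      -- `e1` and `e2` bound the linear term of the energy difference below by `0`, and `e3` does
      -- the same for the quadratic term. If the energies satisfy the reverse inequality, the
      -- quadratic term must vanish.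
      have e1 : F ≤ ∫ z, V z ∂ν + 2 * ∫ p, logKernel p.1 p.2 ∂(ν.prod μ₀) := by
        rw [integral_prod _ h3, ← integral_const_mul, ← integral_add h1 (hU.const_mul 2)]
        calc F = ∫ _, F ∂ν := by simp
          _ ≤ _ := integral_mono (integrable_const F) (h1.add (hU.const_mul 2)) hle
      have e2 : ∫ z, V z ∂μ₀ + 2 * ∫ p, logKernel p.1 p.2 ∂(μ₀.prod μ₀) = F := by
        rw [integral_prod _ hk, ← integral_const_mul, ← integral_add hV (hU₀.const_mul 2),
          integral_congr_ae heq]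
        simp
      have e3 := logEnergy_sub_nonneg hν.measure_singleton hμ₀.measure_singleton h2 hk h3
      refine ⟨by linarith, fun e4 => ?_⟩
      exact eq_of_logEnergy_sub_eq_zero hν.measure_singleton hμ₀.measure_singleton h2 hk h3
        (by linarith)
    · rw [energy, if_neg h]
      exact ⟨le_top, fun h' => absurd (top_le_iff.1 h') (EReal.coe_ne_top _)⟩
  have hinf : energy V μ₀ = ⨅ (ν : Measure ℂ) (_ : IsAdmissibleMeasure Set.univ ν), energy V ν :=
    le_antisymm (le_iInf₂ fun ν hν => (key ν hν).1) (iInf₂_le μ₀ hμ₀)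
  constructor
  · rintro ⟨h1, h2⟩
    exact (key μ h1).2 (h2.trans hinf.symm).le
  · rintro rfl
    exact ⟨hμ₀, hinf⟩

/-! ### The Gaussian potential -/

lemma continuous_gaussianPotential (t₀ : ℝ) (t₂ : ℂ) : Continuous (gaussianPotential t₀ t₂) := by
  unfold gaussianPotential; fun_prop

lemma mul_norm_sq_le_gaussianPotential {t₀ : ℝ} (ht₀ : 0 < t₀) (t₂ z : ℂ) :
    (1 - 2 * ‖t₂‖) / t₀ * ‖z‖ ^ 2 ≤ gaussianPotential t₀ t₂ z := by
  rw [gaussianPotential, div_mul_eq_mul_div]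
  gcongr
  have := Complex.re_le_norm (t₂ * z ^ 2)
  rw [norm_mul, norm_pow] at this
  linarith

/-- For `‖t₂‖ < 1 / 2` the potential dominates a positive multiple of `‖z‖ ^ 2`, so a finite
potential integral gives a second moment, hence a first. -/
lemma integrable_norm_of_integrable_gaussianPotential {t₀ : ℝ} (ht₀ : 0 < t₀) {t₂ : ℂ}
    (ht₂ : ‖t₂‖ < 1 / 2) {ν : Measure ℂ} [IsFiniteMeasure ν]
    (h : Integrable (gaussianPotential t₀ t₂) ν) : Integrable (fun z => ‖z‖) ν := by
  have hc : 0 < (1 - 2 * ‖t₂‖) / t₀ := div_pos (by linarith) ht₀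
  refine ((integrable_const (1 : ℝ)).add (h.const_mul ((1 - 2 * ‖t₂‖) / t₀)⁻¹)).mono (by fun_prop)
    (ae_of_all _ fun z => ?_)
  have h1 := mul_norm_sq_le_gaussianPotential ht₀ t₂ z
  rw [← le_inv_mul_iff₀ hc] at h1
  rw [norm_norm]
  refine le_trans ?_ (le_abs_self _)
  simp only [Pi.add_apply]
  nlinarith [sq_nonneg (‖z‖ - 1)]

/-- The rotation by `s` absorbs the argument of `t₂`, as `t₂ z² = |t₂| (sz)²`. -/
lemma gaussianPotential_eq_ellipsePotential {t₀ : ℝ} {t₂ s : ℂ} {α β : ℝ} (hs : ‖s‖ = 1)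
    (hst : s ^ 2 * (‖t₂‖ : ℂ) = t₂) (h₁ : α ^ 2 - β ^ 2 = t₀) (h₂ : β / α = 2 * ‖t₂‖) (z : ℂ) :
    gaussianPotential t₀ t₂ z = ellipsePotential α β (s * z) := by
  have e : t₂ * z ^ 2 = (‖t₂‖ : ℝ) * (s * z) ^ 2 := by
    conv_lhs => rw [← hst]
    ring
  rw [gaussianPotential, ellipsePotential, h₁, h₂, norm_mul, hs, one_mul, e, Complex.re_ofReal_mul,
    mul_assoc]

theorem proposition6p4 (t₀ : ℝ) (ht₀ : 0 < t₀) (t₂ : ℂ) (ht₂ : ‖t₂‖ < 1 / 2)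
    (a b : ℝ) (ha : a = Real.sqrt ((1 + 2 * ‖t₂‖) / (1 - 2 * ‖t₂‖) * t₀))
    (hb : b = Real.sqrt ((1 - 2 * ‖t₂‖) / (1 + 2 * ‖t₂‖) * t₀))
    (s : ℂ) (hs : ‖s‖ = 1) (hst : s ^ 2 * (‖t₂‖ : ℂ) = t₂) (μ : Measure ℂ) :
    IsEquilibriumMeasure (gaussianPotential t₀ t₂) Set.univ μ ↔
      μ = ENNReal.ofReal (1 / (Real.pi * a * b)) •
        (volume : Measure ℂ).restrict (ellipseInterior s a b) := by
  have hτ := norm_nonneg t₂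
  have hm : 0 < 1 - 2 * ‖t₂‖ := by linarith
  have hp : 0 < 1 + 2 * ‖t₂‖ := by linarith
  have hb0 : 0 < b := by rw [hb]; exact Real.sqrt_pos.2 (by positivity)
  have hab : a = (1 + 2 * ‖t₂‖) / (1 - 2 * ‖t₂‖) * b := by
    rw [ha, hb, ← Real.sqrt_sq (by positivity : 0 ≤ (1 + 2 * ‖t₂‖) / (1 - 2 * ‖t₂‖)),
      ← Real.sqrt_mul (by positivity)]
    rw [Real.sqrt_sq (by positivity)]
    congr 1
    field_simp
  have hbsq : b ^ 2 = (1 - 2 * ‖t₂‖) / (1 + 2 * ‖t₂‖) * t₀ := by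
    rw [hb, Real.sq_sqrt (by positivity)]
  have hbt : a * b = t₀ := by
    rw [hab, mul_assoc, ← sq, hbsq]; field_simp
  have hle : b ≤ a := by
    rw [hab]
    exact le_mul_of_one_le_left hb0.le ((one_le_div hm).2 (by linarith))
  -- With these parameters `α² - β² = ab = t₀` and `β/α = (a - b)/(a + b) = 2 ‖t₂‖`, which match `V`
  -- with `ellipsePotential`.
  obtain ⟨α, β, rfl, rfl⟩ : ∃ α β : ℝ, a = α + β ∧ b = α - β :=
    ⟨(a + b) / 2, (a - b) / 2, by ring, by ring⟩
  have hβ : 0 ≤ β := by linarith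
  have hαβ : β < α := by linarith
  have hα : 0 < α := by linarith
  have ha0 : 0 < α + β := by linarith
  have hV := gaussianPotential_eq_ellipsePotential (t₀ := t₀) hs hst (α := α) (β := β)
    (by rw [← hbt]; ring)
    (by
      rw [div_mul_eq_mul_div, eq_div_iff hm.ne'] at hab
      rw [div_eq_iff hα.ne']; linarith)
  have hDb := isBounded_ellipseInterior hs ha0 hb0
  have hDm := (isOpen_ellipseInterior s (α + β) (α - β)).measurableSet
  have hprob := isProbabilityMeasure_ellipseMeasure hs hβ hαβ
  have hadm : IsAdmissibleMeasure Set.univ (ellipseMeasure s (α + β) (α - β)) :=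
    ⟨hprob, ellipseMeasure_singleton s _ _, by simp⟩
  have hVi : Integrable (gaussianPotential t₀ t₂) (ellipseMeasure s (α + β) (α - β)) := by
    refine Integrable.smul_measure ?_ ENNReal.ofReal_ne_top
    exact ((continuous_gaussianPotential t₀ t₂).continuousOn.integrableOn_compact
      hDb.isCompact_closure).mono_set subset_closure
  have hcross : ∀ ν, IsAdmissibleMeasure Set.univ ν → Integrable (gaussianPotential t₀ t₂) ν →
      Integrable (fun p : ℂ × ℂ => logKernel p.1 p.2)
        (ν.prod (ellipseMeasure s (α + β) (α - β))) := by
    intro ν hν hi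
    have := hν.isProbabilityMeasure
    exact integrable_logKernel_prod (integrable_norm_of_integrable_gaussianPotential ht₀ ht₂ hi)
      hDb hDm ENNReal.ofReal_ne_top
  refine isEquilibriumMeasure_iff_of_variational hadm hVi (hcross _ hadm hVi) hcross
    (F := robinConstant α) (fun z => ?_) ?_ μ
  · rw [hV]
    exact robinConstant_le hs hβ hαβ z
  · refine Measure.ae_smul_measure ?_ _
    filter_upwards [ae_restrict_mem hDm] with z hz
    rw [hV]
    exact robinConstant_eq hs hβ hαβ hz

end
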